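/- All complex spaces are Hausdorff, and *variety* means normal irreducible reduced complex (analytic) space. A prime divisor is an irreducible closed analytic subset of pure codimension one. An orbifold pair $(Y,\Delta)$ is a variety $Y$ with a divisor $\Delta=\sum_i\left(1-\frac1{m_i}\right)\Delta_i$, where $(\Delta_i)$ is a locally finite family of distinct prime divisors and $m_i\in\{2,3,\dots\}\cup\{\infty\}$; put $\lceil\Delta\rceil=\bigcup_i\Delta_i$, $m_Y(\Delta_i)=m_i$, and $m_Y(D)=1$ for every other prime divisor $D$ of $Y$. Let $f\colon X\to Y$ be holomorphic, $D$ a prime divisor of $Y$ and $E$ a component of $f^{-1}(D)$ of codimension one. The multiplicity $t_{E,D}$ of $E$ in $f^*D$ is the smallest order of vanishing along $E$, at general points of $E$, of the functions $g\circ f$, where $g$ is a holomorphic germ on $Y$ vanishing on $D$ (if $D$ is Cartier, this is the order of $g\circ f$ for a local equation $g$ of $D$). The map $f$ is an orbifold morphism $(X,\Delta_X)\to(Y,\Delta_Y)$ if $f(X)\not\subset\lceil\Delta_Y\rceil$ and $t_{E,D}\cdot m_X(E)\ge m_Y(D)$ for all such $D$ and $E$. A variety $X$ is identified with the orbifold pair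 $(X,0)$, and $\mathrm{Hol}(X,(Y,\Delta))$ denotes the set of orbifold morphisms $X\to(Y,\Delta)$. **Theorem.** Let $X$ be a variety and $(Y,\Delta)$ an orbifold pair with $\Delta=\sum_i\left(1-\frac1{m_i}\right)\Delta_i$. Let $\mathcal F\subset\mathrm{Hol}(X,(Y,\Delta))$ be a subset which is locally closed in the space $\mathrm{Hol}(X,Y)$ of holomorphic maps (with the compact-open topology), and which, with its subspace topology, carries a structure of variety (in particular normal) for which the evaluation map $$ev\colon X\times\mathcal F\to Y,\qquad (x,f)\mapsto f(x)$$ is holomorphic. Then $ev\colon X\times\mathcal F\to(Y,\Delta)$ is an orbifold morphism. In particular, for every $i$, every component of $ev^*\Delta_i$ has multiplicity at least $m_i$. -/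

import Mathlib

open Set Filter Topology

/-- A *local model* on the open set `U`, for a notion `H u x` of "the function `u` is holomorphic
at `x`": the map `φ` identifies `U` with the common zero set of finitely many holomorphic functions
on an open subset `Ω` of `ℂⁿ`, and the holomorphic germs on `U` are exactly the restrictions
of the germs of holomorphic functions of `n` variables. -/
structure IsLocalModel {X : Type*} [TopologicalSpace X] (H : (X → ℂ) → X → Prop)
    (n : ℕ) (U : Set X) (φ : X → (Fin n → ℂ)) (Ω : Set (Fin n → ℂ)) : Prop where
  isOpen_source : IsOpen U
  isOpen_ambient : IsOpen Ω
  isEmbedding : IsEmbedding (U.domRestrict φ)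
  image_analytic : ∃ S : Set ((Fin n → ℂ) → ℂ), S.Finite ∧ (∀ g ∈ S, AnalyticOnNhd ℂ g Ω) ∧
    φ '' U = {z | z ∈ Ω ∧ ∀ g ∈ S, g z = 0}
  hol_iff : ∀ x ∈ U, ∀ u : X → ℂ, H u x ↔
    ∃ G : (Fin n → ℂ) → ℂ, AnalyticAt ℂ G (φ x) ∧ u =ᶠ[𝓝 x] fun y => G (φ y)

/-- A reduced complex (analytic) space, given by its sheaf of holomorphic functions:
`HolAt u x` says that the germ at `x` of the function `u` is holomorphic. -/
class ComplexSpace (X : Type*) [TopologicalSpace X] where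
  HolAt : (X → ℂ) → X → Prop
  exists_localModel : ∀ x : X, ∃ (n : ℕ) (U : Set X) (φ : X → (Fin n → ℂ)) (Ω : Set (Fin n → ℂ)),
    x ∈ U ∧ IsLocalModel HolAt n U φ Ω

namespace ComplexSpace

section Basic

variable {X : Type*} [TopologicalSpace X] [ComplexSpace X]

theorem holAt_const (c : ℂ) (x : X) : HolAt (fun _ => c) x := by
  obtain ⟨n, U, φ, Ω, hx, hm⟩ := exists_localModel x
  exact (hm.hol_iff x hx _).2 ⟨fun _ => c, analyticAt_const, Eventually.of_forall fun _ => rfl⟩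

theorem HolAt.add {u v : X → ℂ} {x : X} (hu : HolAt u x) (hv : HolAt v x) :
    HolAt (fun y => u y + v y) x := by
  obtain ⟨n, U, φ, Ω, hx, hm⟩ := exists_localModel x
  obtain ⟨G, hG, e⟩ := (hm.hol_iff x hx u).1 hu
  obtain ⟨G', hG', e'⟩ := (hm.hol_iff x hx v).1 hv
  refine (hm.hol_iff x hx _).2 ⟨fun z => G z + G' z, hG.add hG', ?_⟩
  filter_upwards [e, e'] with y h h'
  rw [h, h']

theorem HolAt.mul {u v : X → ℂ} {x : X} (hu : HolAt u x) (hv : HolAt v x) :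
    HolAt (fun y => u y * v y) x := by
  obtain ⟨n, U, φ, Ω, hx, hm⟩ := exists_localModel x
  obtain ⟨G, hG, e⟩ := (hm.hol_iff x hx u).1 hu
  obtain ⟨G', hG', e'⟩ := (hm.hol_iff x hx v).1 hv
  refine (hm.hol_iff x hx _).2 ⟨fun z => G z * G' z, hG.mul hG', ?_⟩
  filter_upwards [e, e'] with y h h'
  rw [h, h']

/-- The local ring of germs of holomorphic functions at `x`. -/
def holGerms (x : X) : Subring (Germ (𝓝 x) ℂ) where
  carrier := {a | ∃ u : X → ℂ, HolAt u x ∧ a = (u : Germ (𝓝 x) ℂ)}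
  mul_mem' := by
    rintro _ _ ⟨u, hu, rfl⟩ ⟨v, hv, rfl⟩
    exact ⟨_, hu.mul hv, rfl⟩
  one_mem' := ⟨_, holAt_const 1 x, rfl⟩
  add_mem' := by
    rintro _ _ ⟨u, hu, rfl⟩ ⟨v, hv, rfl⟩
    exact ⟨_, hu.add hv, rfl⟩
  zero_mem' := ⟨_, holAt_const 0 x, rfl⟩
  neg_mem' := by
    rintro _ ⟨u, hu, rfl⟩
    refine ⟨fun y => (-1) * u y, (holAt_const (-1) x).mul hu, ?_⟩
    rw [← Germ.coe_neg]
    congr 1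
    funext y
    simp

/-- `φ` is a system of local coordinates on `U`: a biholomorphic map from `U` onto an open subset
of `ℂⁿ`. -/
def IsCoordinates (n : ℕ) (U : Set X) (φ : X → (Fin n → ℂ)) : Prop :=
  IsLocalModel (HolAt (X := X)) n U φ (φ '' U)

variable (X) in
/-- The set of regular (smooth) points of `X`. -/
def regularLocus : Set X :=
  {x | ∃ (n : ℕ) (U : Set X) (φ : X → (Fin n → ℂ)), x ∈ U ∧ IsCoordinates n U φ}

/-- Closed analytic subsets: locally (near every point of `X`) the common zero set of finitely many
holomorphic functions. -/
def IsAnalyticSubset (A : Set X) : Prop :=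
  ∀ x : X, ∃ (U : Set X) (S : Set (X → ℂ)), IsOpen U ∧ x ∈ U ∧ S.Finite ∧
    (∀ u ∈ S, ∀ y ∈ U, HolAt u y) ∧ A ∩ U = {y | y ∈ U ∧ ∀ u ∈ S, u y = 0}

/-- The points of `A` which are regular points of `X` and at which `A` is a smooth
hypersurface, given by the vanishing of the first coordinate in suitable local coordinates. -/
def hypersurfaceLocus (A : Set X) : Set X :=
  {x | x ∈ A ∧ ∃ (n : ℕ) (U : Set X) (φ : X → (Fin (n + 1) → ℂ)), x ∈ U ∧ IsCoordinates (n + 1) U φ ∧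
    ∀ y ∈ U, y ∈ A ↔ φ y 0 = 0}

/-- Irreducible (prime Weil) divisors of a normal complex space: the analytic subsets of
pure codimension one whose regular part (outside the singular locus of the space, which has
codimension at least two) is connected. -/
structure IsPrimeDivisor (A : Set X) : Prop where
  analytic : IsAnalyticSubset A
  connected : IsConnected (hypersurfaceLocus A)
  dense : A ⊆ closure (hypersurfaceLocus A)

/-- `E` is an irreducible component of codimension one of the analytic subset `A`:
the closure of a connected component of the regular part of `A`. -/
def IsDivisorComponent (A E : Set X) : Prop :=
  ∃ x ∈ hypersurfaceLocus A, E = closure (connectedComponentIn (hypersurfaceLocus A) x)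

/-- Near `x`, the function `w` is a holomorphic multiple of the `k`-th power of a holomorphic
function vanishing on `A`. At a point where `A` is a smooth hypersurface `{z₀ = 0}`, it says
that `z₀ ^ k` divides `w`, that is, that `w` vanishes to order at least `k` along `A`. -/
def VanishesToOrder (A : Set X) (x : X) (k : ℕ) (w : X → ℂ) : Prop :=
  ∃ h u : X → ℂ, HolAt h x ∧ HolAt u x ∧ (∀ᶠ y in 𝓝 x, y ∈ A → h y = 0) ∧
    w =ᶠ[𝓝 x] fun y => u y * h y ^ k

end Basic

/-- Complex varieties, irreducible, reduced and normal: Hausdorff reduced complex spaces with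
connected (and non-empty) regular locus, all of whose local rings are integrally closed domains. -/
structure IsNormalVariety (X : Type*) [TopologicalSpace X] [ComplexSpace X] : Prop where
  t2 : T2Space X
  irreducible : IsConnected (regularLocus X)
  normal : ∀ x : X, IsDomain (holGerms x) ∧ IsIntegrallyClosed (holGerms x)

section Product

variable {X : Type*} [TopologicalSpace X] {Y : Type*} [TopologicalSpace Y]

theorem analyticAt_append {n m : ℕ} (p : (Fin n → ℂ) × (Fin m → ℂ)) :
    AnalyticAt ℂ (fun q : (Fin n → ℂ) × (Fin m → ℂ) => (Fin.append q.1 q.2 : Fin (n + m) → ℂ)) p := by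
  rw [analyticAt_pi_iff]
  intro i
  refine Fin.addCases (fun i => ?_) (fun i => ?_) i
  · simp only [Fin.append_left]
    exact ((ContinuousLinearMap.proj (R := ℂ) (φ := fun _ : Fin n => ℂ) i).comp
      (ContinuousLinearMap.fst ℂ (Fin n → ℂ) (Fin m → ℂ))).analyticAt p
  · simp only [Fin.append_right]
    exact ((ContinuousLinearMap.proj (R := ℂ) (φ := fun _ : Fin m => ℂ) i).comp
      (ContinuousLinearMap.snd ℂ (Fin n → ℂ) (Fin m → ℂ))).analyticAt p

/-- The first projection of `ℂⁿ⁺ᵐ = ℂⁿ × ℂᵐ`. -/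
def splitFst {n m : ℕ} (z : Fin (n + m) → ℂ) : Fin n → ℂ := fun i => z (Fin.castAdd m i)

/-- The second projection of `ℂⁿ⁺ᵐ = ℂⁿ × ℂᵐ`. -/
def splitSnd {n m : ℕ} (z : Fin (n + m) → ℂ) : Fin m → ℂ := fun i => z (Fin.natAdd n i)

theorem splitFst_append {n m : ℕ} (a : Fin n → ℂ) (b : Fin m → ℂ) :
    splitFst (Fin.append a b) = a := by
  funext i; simp [splitFst]

theorem splitSnd_append {n m : ℕ} (a : Fin n → ℂ) (b : Fin m → ℂ) :
    splitSnd (Fin.append a b) = b := by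
  funext i; simp [splitSnd]

theorem append_split {n m : ℕ} (z : Fin (n + m) → ℂ) :
    Fin.append (splitFst z) (splitSnd z) = z := by
  funext i
  refine Fin.addCases (fun i => ?_) (fun i => ?_) i <;> simp [splitFst, splitSnd]

theorem analyticAt_splitFst {n m : ℕ} (z : Fin (n + m) → ℂ) :
    AnalyticAt ℂ (splitFst (n := n) (m := m)) z := by
  rw [analyticAt_pi_iff]
  exact fun i => (ContinuousLinearMap.proj (R := ℂ) (φ := fun _ : Fin (n + m) => ℂ)
    (Fin.castAdd m i)).analyticAt z

theorem analyticAt_splitSnd {n m : ℕ} (z : Fin (n + m) → ℂ) :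
    AnalyticAt ℂ (splitSnd (n := n) (m := m)) z := by
  rw [analyticAt_pi_iff]
  exact fun i => (ContinuousLinearMap.proj (R := ℂ) (φ := fun _ : Fin (n + m) => ℂ)
    (Fin.natAdd n i)).analyticAt z

theorem continuous_splitFst {n m : ℕ} : Continuous (splitFst (n := n) (m := m)) :=
  continuous_pi fun _ => continuous_apply _

theorem continuous_splitSnd {n m : ℕ} : Continuous (splitSnd (n := n) (m := m)) :=
  continuous_pi fun _ => continuous_apply _

/-- Holomorphic germs on a product: the holomorphic functions of finitely many
holomorphic germs on the two factors. -/
def ProdHolAt (HX : (X → ℂ) → X → Prop) (HY : (Y → ℂ) → Y → Prop) (w : X × Y → ℂ) (p : X × Y) :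
    Prop :=
  ∃ (n m : ℕ) (u : Fin n → X → ℂ) (v : Fin m → Y → ℂ) (G : (Fin n → ℂ) × (Fin m → ℂ) → ℂ),
    (∀ i, HX (u i) p.1) ∧ (∀ j, HY (v j) p.2) ∧
    AnalyticAt ℂ G (fun i => u i p.1, fun j => v j p.2) ∧
    w =ᶠ[𝓝 p] fun q => G (fun i => u i q.1, fun j => v j q.2)

theorem IsLocalModel.prod {HX : (X → ℂ) → X → Prop} {HY : (Y → ℂ) → Y → Prop} {n m : ℕ}
    {U : Set X} {φ : X → (Fin n → ℂ)} {Ω : Set (Fin n → ℂ)}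
    {V : Set Y} {ψ : Y → (Fin m → ℂ)} {Θ : Set (Fin m → ℂ)}
    (h : IsLocalModel HX n U φ Ω) (k : IsLocalModel HY m V ψ Θ) :
    IsLocalModel (ProdHolAt HX HY) (n + m) (U ×ˢ V) (fun p => Fin.append (φ p.1) (ψ p.2))
      {z | splitFst z ∈ Ω ∧ splitSnd z ∈ Θ} where
  isOpen_source := h.isOpen_source.prod k.isOpen_source
  isOpen_ambient := (h.isOpen_ambient.preimage continuous_splitFst).inter
    (k.isOpen_ambient.preimage continuous_splitSnd)
  isEmbedding := by
    have e1 : IsEmbedding (fun p : ↥(U ×ˢ V) =>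
        ((⟨p.1.1, p.2.1⟩ : U), (⟨p.1.2, p.2.2⟩ : V))) := by
      refine IsEmbedding.of_comp (g := Prod.map Subtype.val Subtype.val) ?_ ?_ ?_
      · exact Continuous.prodMk
          ((continuous_fst.comp continuous_subtype_val).subtype_mk _)
          ((continuous_snd.comp continuous_subtype_val).subtype_mk _)
      · exact continuous_subtype_val.prodMap continuous_subtype_val
      · exact IsEmbedding.subtypeVal
    have e2 := h.isEmbedding.prodMap k.isEmbedding
    have e3 : IsEmbedding (fun q : (Fin n → ℂ) × (Fin m → ℂ) =>
        (Fin.append q.1 q.2 : Fin (n + m) → ℂ)) := by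
      refine IsEmbedding.of_leftInverse (f := fun z => (splitFst z, splitSnd z)) ?_ ?_ ?_
      · intro q
        simp only [splitFst_append, splitSnd_append]
      · exact continuous_splitFst.prodMk continuous_splitSnd
      · exact continuous_iff_continuousAt.2 fun q => (analyticAt_append q).continuousAt
    exact e3.comp (e2.comp e1)
  image_analytic := by
    obtain ⟨S, hS, hSa, hSe⟩ := h.image_analytic
    obtain ⟨T, hT, hTa, hTe⟩ := k.image_analytic
    refine ⟨(fun g z => g (splitFst z)) '' S ∪ (fun g z => g (splitSnd z)) '' T,
      (hS.image _).union (hT.image _), ?_, ?_⟩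
    · rintro _ (⟨g, hg, rfl⟩ | ⟨g, hg, rfl⟩) z hz
      · exact (hSa g hg _ hz.1).comp (analyticAt_splitFst z)
      · exact (hTa g hg _ hz.2).comp (analyticAt_splitSnd z)
    · ext z
      constructor
      · rintro ⟨⟨x, y⟩, ⟨hx, hy⟩, rfl⟩
        have h1 : φ x ∈ φ '' U := ⟨x, hx, rfl⟩
        have h2 : ψ y ∈ ψ '' V := ⟨y, hy, rfl⟩
        rw [hSe] at h1
        rw [hTe] at h2
        refine ⟨⟨?_, ?_⟩, ?_⟩
        · simpa only [splitFst_append] using h1.1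
        · simpa only [splitSnd_append] using h2.1
        · rintro _ (⟨g, hg, rfl⟩ | ⟨g, hg, rfl⟩)
          · simpa only [splitFst_append] using h1.2 g hg
          · simpa only [splitSnd_append] using h2.2 g hg
      · rintro ⟨⟨h1, h2⟩, h3⟩
        have h4 : splitFst z ∈ φ '' U := by
          rw [hSe]
          exact ⟨h1, fun g hg => h3 _ (Or.inl ⟨g, hg, rfl⟩)⟩
        have h5 : splitSnd z ∈ ψ '' V := by
          rw [hTe]
          exact ⟨h2, fun g hg => h3 _ (Or.inr ⟨g, hg, rfl⟩)⟩
        obtain ⟨x, hx, ex⟩ := h4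
        obtain ⟨y, hy, ey⟩ := h5
        refine ⟨(x, y), ⟨hx, hy⟩, ?_⟩
        simp only [ex, ey, append_split]
  hol_iff := by
    rintro ⟨x, y⟩ ⟨hx, hy⟩ w
    constructor
    · rintro ⟨a, b, u, v, G, hu, hv, hG, e⟩
      choose A hA eA using fun i => (h.hol_iff x hx (u i)).1 (hu i)
      choose B hB eB using fun j => (k.hol_iff y hy (v j)).1 (hv j)
      refine ⟨fun z => G (fun i => A i (splitFst z), fun j => B j (splitSnd z)), ?_, ?_⟩
      · refine AnalyticAt.fun_comp ?_ (AnalyticAt.prod ?_ ?_)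
        · simp only [splitFst_append, splitSnd_append]
          have e1 : (fun i => A i (φ x)) = fun i => u i x := by
            funext i; exact (eA i).self_of_nhds.symm
          have e2 : (fun j => B j (ψ y)) = fun j => v j y := by
            funext j; exact (eB j).self_of_nhds.symm
          rw [e1, e2]
          exact hG
        · rw [analyticAt_pi_iff]
          intro i
          refine AnalyticAt.fun_comp ?_ (analyticAt_splitFst _)
          rw [splitFst_append]
          exact hA i
        · rw [analyticAt_pi_iff]
          intro j
          refine AnalyticAt.fun_comp ?_ (analyticAt_splitSnd _)
          rw [splitSnd_append]
          exact hB j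
      · have E1 : ∀ᶠ q : X × Y in 𝓝 (x, y), ∀ i, u i q.1 = A i (φ q.1) :=
          eventually_all.2 fun i => (continuous_fst.tendsto (x, y)).eventually (eA i)
        have E2 : ∀ᶠ q : X × Y in 𝓝 (x, y), ∀ j, v j q.2 = B j (ψ q.2) :=
          eventually_all.2 fun j => (continuous_snd.tendsto (x, y)).eventually (eB j)
        filter_upwards [e, E1, E2] with q hq h1 h2
        rw [hq]
        simp only [splitFst_append, splitSnd_append, h1, h2]
    · rintro ⟨G, hG, e⟩
      refine ⟨n, m, fun i x' => φ x' i, fun j y' => ψ y' j, fun q => G (Fin.append q.1 q.2),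
        fun i => (h.hol_iff x hx _).2 ⟨fun z => z i, ?_, Eventually.of_forall fun _ => rfl⟩,
        fun j => (k.hol_iff y hy _).2 ⟨fun z => z j, ?_, Eventually.of_forall fun _ => rfl⟩, ?_, e⟩
      · exact (ContinuousLinearMap.proj (R := ℂ) (φ := fun _ : Fin n => ℂ) i).analyticAt _
      · exact (ContinuousLinearMap.proj (R := ℂ) (φ := fun _ : Fin m => ℂ) j).analyticAt _
      · exact AnalyticAt.fun_comp hG (analyticAt_append _)

/-- The product of two reduced complex spaces. -/
instance instProd [ComplexSpace X] [ComplexSpace Y] : ComplexSpace (X × Y) where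
  HolAt := ProdHolAt HolAt HolAt
  exists_localModel := by
    rintro ⟨x, y⟩
    obtain ⟨n, U, φ, Ω, hx, h⟩ := exists_localModel x
    obtain ⟨m, V, ψ, Θ, hy, k⟩ := exists_localModel y
    exact ⟨_, _, _, _, mk_mem_prod hx hy, IsLocalModel.prod h k⟩

end Product

section Maps

variable {X : Type*} [TopologicalSpace X] [ComplexSpace X]
  {Y : Type*} [TopologicalSpace Y] [ComplexSpace Y]

/-- Holomorphic maps between reduced complex spaces. -/
structure IsHolomorphicMap (f : X → Y) : Prop where
  continuous : Continuous f
  holAt_comp : ∀ (x : X) (g : Y → ℂ), HolAt g (f x) → HolAt (fun x' => g (f x')) x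

variable (X Y) in
/-- The set `Hol(X, Y)` of holomorphic maps from `X` to `Y`. -/
structure HolMap where
  toFun : X → Y
  isHolomorphicMap : IsHolomorphicMap toFun

/-- The continuous map underlying a holomorphic map. -/
def HolMap.toContinuousMap (f : HolMap X Y) : C(X, Y) :=
  ⟨f.toFun, f.isHolomorphicMap.continuous⟩

/-- `Hol(X, Y)` carries the compact-open topology. -/
instance HolMap.instTopologicalSpace : TopologicalSpace (HolMap X Y) :=
  TopologicalSpace.induced HolMap.toContinuousMap inferInstance

/-- The evaluation map `X × F → Y`, `(x, f) ↦ f x`, of a family `F` of holomorphic maps. -/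
def evalMap (F : Set (HolMap X Y)) (p : X × F) : Y :=
  p.2.1.toFun p.1

/-- The order at `x` of the pull-back `f^* D` along `f⁻¹(D)`: the largest `k` such that `g ∘ f`
vanishes to order at least `k` along `f⁻¹(D)` for every holomorphic germ `g` at `f x` which
vanishes on `D` (if `D` is Cartier, it is enough to take for `g` a local equation of `D`). -/
noncomputable def pullbackOrderAt (f : X → Y) (D : Set Y) (x : X) : ℕ∞ :=
  ⨆ (k : ℕ) (_ : ∀ g : Y → ℂ, HolAt g (f x) → (∀ᶠ y in 𝓝 (f x), y ∈ D → g y = 0) →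
    VanishesToOrder (f ⁻¹' D) x k fun x' => g (f x')), (k : ℕ∞)

/-- The multiplicity `t` of the component `E` of `f⁻¹(D)` in the pull-back `f^* D = t E + R`: the
order of `f^* D` at the points of `E` where `f⁻¹(D)` is a smooth hypersurface
(the order is the same at all these points). -/
noncomputable def pullbackMultiplicity (f : X → Y) (D : Set Y) (E : Set X) : ℕ∞ :=
  ⨅ x ∈ E ∩ hypersurfaceLocus (f ⁻¹' D), pullbackOrderAt f D x

variable (X) in
/-- The boundary `Δ = ∑ (1 - 1 / m_D) D` of an orbifold pair `(X, Δ)`, recorded by its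
orbifold multiplicities `m_D`, with `m_D = 1` for the prime divisors `D` that do not occur. -/
structure OrbifoldDivisor where
  mult : Set X → ℕ∞
  one_le_mult : ∀ D, 1 ≤ mult D
  isPrimeDivisor : ∀ D, mult D ≠ 1 → IsPrimeDivisor D
  locallyFinite : LocallyFinite fun D : {D : Set X // mult D ≠ 1} => (D : Set X)

/-- The support `⌈Δ⌉`. -/
def OrbifoldDivisor.support (Δ : OrbifoldDivisor X) : Set X :=
  {x | ∃ D : Set X, Δ.mult D ≠ 1 ∧ x ∈ D}

variable (X) in
/-- The zero boundary: no orbifold structure. -/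
def OrbifoldDivisor.trivial : OrbifoldDivisor X where
  mult _ := 1
  one_le_mult _ := le_rfl
  isPrimeDivisor _ h := absurd rfl h
  locallyFinite := by
    have : IsEmpty {D : Set X // (1 : ℕ∞) ≠ 1} := ⟨fun D => D.2 rfl⟩
    exact fun x => ⟨univ, univ_mem, Set.toFinite _⟩

/-- Orbifold morphisms `(X, ΔX) → (Y, ΔY)`: holomorphic maps `f` with `f(X) ⊄ ⌈ΔY⌉` such that
`t * m_X(E) ≥ m_Y(D)` whenever `f^* D = t E + R` with prime divisors `D` of `Y`, `E` of `X`
and `R` an effective divisor not containing `E`. -/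
structure IsOrbifoldMorphism (ΔX : OrbifoldDivisor X) (ΔY : OrbifoldDivisor Y) (f : X → Y) :
    Prop where
  isHolomorphicMap : IsHolomorphicMap f
  not_subset_support : ¬ range f ⊆ ΔY.support
  mult_le : ∀ D : Set Y, IsPrimeDivisor D → ∀ E : Set X, IsDivisorComponent (f ⁻¹' D) E →
    ΔY.mult D ≤ pullbackMultiplicity f D E * ΔX.mult E

end Maps

end ComplexSpace

/-!
Write `ev⁻¹(D) = {s = 0}` near a point `(x₀, t₀)` at which it is a smooth hypersurface, and suppose
that a function `g` vanishing on `D` pulls back to `sʲ v` with `j < m(D)`. Where a derivative of `s`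
along `X` does not vanish, the slice `X × {t}` meets the hypersurface transversally, so `s` is a
local equation of `f_t⁻¹(D)` in the slice, and the orbifold condition for `f_t` gives `v = 0`. Hence
the product of `v` with every derivative of `s` along `X` vanishes on the irreducible germ
`{s = 0}`. Either `v` vanishes there, and one more factor `s` can be split off `g ∘ ev`; or all
these derivatives are multiples of `s`, so `s(·, t₀)` solves a linear differential equation along
each line and vanishes near `x₀`. In the second case `f_{t₀}⁻¹(D)` has interior, hence is all of
`X` by the identity theorem, which contradicts `f_{t₀}(X) ⊄ ⌈Δ⌉`.

The derivatives along `X` make sense because a regular point of a product has a regular first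
coordinate: embedding both factors minimally, no germ vanishing on the product has a non-zero
differential, so the image of the product in the affine space is a neighbourhood of the point.
-/
section HyperplaneQuotient

variable {𝕜 E F : Type*} [NontriviallyNormedField 𝕜] [NormedAddCommGroup E] [NormedSpace 𝕜 E]
  [NormedAddCommGroup F] [NormedSpace 𝕜 F]

/-- The power series of `(G y - G (π y)) / ℓ y`, where `p` is the power series of `G` and
`π y = y - ℓ y • e` is the projection along `e` onto the hyperplane `ℓ = 0`: the terms of the sum
are the differences obtained by replacing the arguments of `p (n + 1)` one at a time. -/
noncomputable def hyperplaneQuotient (p : FormalMultilinearSeries 𝕜 E F) (e : E) (π : E →L[𝕜] E) :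
    FormalMultilinearSeries 𝕜 E F := fun n =>
  ∑ i : Fin (n + 1), ((p (n + 1)).curryMid i e).compContinuousLinearMap
    fun j => if i.succAbove j < i then .id 𝕜 E else π

theorem smul_hyperplaneQuotient_apply (p : FormalMultilinearSeries 𝕜 E F) {e : E} {π : E →L[𝕜] E}
    {ℓ : E →L[𝕜] 𝕜} (hπ : ∀ h, h - π h = ℓ h • e) (n : ℕ) (h : E) :
    ℓ h • hyperplaneQuotient p e π n (fun _ => h) =
      p (n + 1) (fun _ => h) - p (n + 1) (fun _ => π h) := by
  have telescope := (p (n + 1)).toMultilinearMap.map_piecewise_sub_map_piecewise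
    (fun _ => h) (fun _ => π h) 0 Finset.univ
  simp only [Finset.piecewise_univ, Finset.mem_univ, if_true, hπ,
    ContinuousMultilinearMap.coe_coe] at telescope
  rw [telescope, hyperplaneQuotient, sum_apply, Finset.smul_sum]
  refine Finset.sum_congr rfl fun i _ => ?_
  rw [ContinuousMultilinearMap.compContinuousLinearMap_apply,
    ← smul_apply, ← map_smul, ContinuousMultilinearMap.curryMid_apply]
  congr 1
  funext j
  refine Fin.succAboveCases i ?_ (fun j => ?_) j
  · simp
  · rw [Fin.insertNth_apply_succAbove, if_neg (Fin.succAbove_ne i j)]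
    split_ifs <;> rfl

theorem norm_hyperplaneQuotient_le (p : FormalMultilinearSeries 𝕜 E F) (e : E) (π : E →L[𝕜] E)
    (n : ℕ) : ‖hyperplaneQuotient p e π n‖ ≤ (n + 1) * (‖p (n + 1)‖ * ‖e‖ * (1 + ‖π‖) ^ n) := by
  refine (norm_sum_le_of_le (f := _) _ fun i _ => ?_).trans
    (b := ∑ _i : Fin (n + 1), ‖p (n + 1)‖ * ‖e‖ * (1 + ‖π‖) ^ n) (by simp)
  refine (ContinuousMultilinearMap.norm_compContinuousLinearMap_le _ _).trans ?_
  gcongr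
  · rw [← ContinuousMultilinearMap.norm_curryMid i]
    exact ContinuousLinearMap.le_opNorm _ _
  · refine (Finset.prod_le_prod (g := fun _ => 1 + ‖π‖) (fun _ _ => norm_nonneg _)
      fun j _ => ?_).trans (by simp)
    split_ifs
    · exact ContinuousLinearMap.norm_id_le.trans (by simp)
    · simp

theorem radius_hyperplaneQuotient_pos {p : FormalMultilinearSeries 𝕜 E F} (hp : 0 < p.radius)
    (e : E) (π : E →L[𝕜] E) : 0 < (hyperplaneQuotient p e π).radius := by
  obtain ⟨C, r, hC, hr, hb⟩ := p.le_mul_pow_of_radius_pos hp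
  set M : ℝ := 2 * r * (1 + ‖π‖)
  have hM : 0 < M := by positivity
  have bound (n : ℕ) : ‖hyperplaneQuotient p e π n‖ ≤ C * r * ‖e‖ * M ^ n :=
    calc ‖hyperplaneQuotient p e π n‖ ≤ (n + 1) * (‖p (n + 1)‖ * ‖e‖ * (1 + ‖π‖) ^ n) :=
          norm_hyperplaneQuotient_le p e π n
      _ ≤ 2 ^ n * (C * r ^ (n + 1) * ‖e‖ * (1 + ‖π‖) ^ n) := by
          gcongr
          · exact_mod_cast Nat.lt_two_pow_self (n := n)
          · exact hb _
      _ = C * r * ‖e‖ * M ^ n := by rw [mul_pow, mul_pow]; ring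
  have hs : 0 < M⁻¹.toNNReal := by simpa using hM
  refine (ENNReal.coe_pos.2 hs).trans_le
    ((hyperplaneQuotient p e π).le_radius_of_bound (C * r * ‖e‖) fun n => ?_)
  rw [Real.coe_toNNReal _ (by positivity), inv_pow]
  exact mul_inv_le_of_le_mul₀ (by positivity) (by positivity) (bound n)

theorem exists_eventually_eq_smul_of_vanishing_on_hyperplane [CompleteSpace F] {G : E → F} {z : E}
    (hG : AnalyticAt 𝕜 G z) {ℓ : E →L[𝕜] 𝕜} (hℓ : ℓ ≠ 0)
    (h0 : ∀ᶠ y in 𝓝 z, ℓ y = ℓ z → G y = 0) :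
    ∃ Q : E → F, AnalyticAt 𝕜 Q z ∧ ∀ᶠ y in 𝓝 z, G y = ℓ (y - z) • Q y := by
  obtain ⟨p, r, hp⟩ := hG
  obtain ⟨e, he⟩ : ∃ e, ℓ e = 1 := LinearMap.surjective (f := ℓ.toLinearMap)
    (by simpa [← ContinuousLinearMap.coe_inj] using hℓ) 1
  set π : E →L[𝕜] E := .id 𝕜 E - ℓ.smulRight e with hπd
  have hπ h : h - π h = ℓ h • e := by simp [hπd]
  have hℓπ h : ℓ (π h) = 0 := by simp [hπd, he]
  set q := hyperplaneQuotient p e π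
  have hq : HasFPowerSeriesOnBall (fun y => q.sum (y - z)) q z q.radius := by
    simpa using (q.hasFPowerSeriesOnBall
      (radius_hyperplaneQuotient_pos (hp.r_pos.trans_le hp.r_le) e π)).comp_sub z
  refine ⟨_, hq.analyticAt, ?_⟩
  have hproj : Tendsto (fun y => z + π (y - z)) (𝓝 z) (𝓝 z) := by
    have : Continuous fun y => z + π (y - z) := by fun_prop
    simpa using this.tendsto z
  filter_upwards [hproj.eventually h0, Metric.eball_mem_nhds z hp.r_pos,
    hproj (Metric.eball_mem_nhds z hp.r_pos), Metric.eball_mem_nhds z hq.r_pos]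
    with y hy0 hyp hyπ hyq
  have hsum := (hp.hasSum_sub hyp).sub (hp.hasSum_sub hyπ)
  rw [hy0 (by simp [hℓπ]), sub_zero, ← hasSum_nat_add_iff' 1] at hsum
  have hconst : p 0 (fun _ => y - z) = p 0 (fun _ => π (y - z)) := by
    congr 1
    exact Subsingleton.elim _ _
  simp only [add_sub_cancel_left, Finset.sum_range_one, hconst, sub_self, sub_zero] at hsum
  refine hsum.unique ?_
  simpa only [q, smul_hyperplaneQuotient_apply p hπ] using
    (hq.hasSum_sub hyq).const_smul (ℓ (y - z))

end HyperplaneQuotient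

section Lines

variable {𝕜 E F : Type*} [NontriviallyNormedField 𝕜] [NormedAddCommGroup E] [NormedSpace 𝕜 E]
  [NormedAddCommGroup F] [NormedSpace 𝕜 F] {G : E → F} {z : E}

theorem eventually_eq_zero_of_forall_line (hG : AnalyticAt 𝕜 G z)
    (h : ∀ v : E, ∀ᶠ t : 𝕜 in 𝓝 0, G (z + t • v) = 0) : ∀ᶠ y in 𝓝 z, G y = 0 := by
  obtain ⟨p, hp⟩ := hG
  have hp0 (n : ℕ) (v : E) : p n (fun _ => v) = 0 := by
    have hp' : HasFPowerSeriesAt (fun y => G (y - -z)) p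
        (ContinuousLinearMap.toSpanSingleton 𝕜 v 0) := by
      simpa using hp.comp_sub (-z)
    have hline := hp'.compContinuousLinearMap.congr
      (show _ =ᶠ[𝓝 0] 0 from (h v).mono fun t ht => by simpa [add_comm] using ht)
    simpa only [FormalMultilinearSeries.compContinuousLinearMap_apply, Function.comp_def,
      ContinuousLinearMap.toSpanSingleton_apply, one_smul] using hline.apply_eq_zero n 1
  filter_upwards [hp.eventually_hasSum_sub] with y hy
  simpa only [hp0, hasSum_zero.unique] using hy.unique (by simp only [hp0, hasSum_zero])

end Lines

section Derivatives

variable {E F : Type*} [NormedAddCommGroup E] [NormedSpace ℂ E] [NormedAddCommGroup F]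
  [NormedSpace ℂ F] {z : E}

theorem analyticAt_comp_line {G : E → F} (hG : AnalyticAt ℂ G z) (v : E) :
    AnalyticAt ℂ (fun t : ℂ => G (z + t • v)) 0 :=
  AnalyticAt.fun_comp (by simpa using hG) (by fun_prop)

theorem tendsto_line_zero (z v : E) : Tendsto (fun t : ℂ => z + t • v) (𝓝 0) (𝓝 z) := by
  have : Continuous fun t : ℂ => z + t • v := by fun_prop
  simpa using this.tendsto 0

variable [CompleteSpace F]

theorem deriv_comp_line_eventuallyEq {G : E → F} (hG : AnalyticAt ℂ G z) (v : E) :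
    deriv (fun t : ℂ => G (z + t • v)) =ᶠ[𝓝 0] fun t => fderiv ℂ G (z + t • v) v := by
  filter_upwards [(tendsto_line_zero z v).eventually hG.eventually_analyticAt] with t ht
  refine (ht.differentiableAt.hasFDerivAt.comp_hasDerivAt t ?_).deriv
  simpa using ((hasDerivAt_id t).smul_const v).const_add z

theorem analyticOrderAt_comp_line_eq {G : E → F} (hG : AnalyticAt ℂ G z) (hz : G z = 0) (v : E) :
    analyticOrderAt (fun t : ℂ => G (z + t • v)) 0 =
      analyticOrderAt (fun t : ℂ => fderiv ℂ G (z + t • v) v) 0 + 1 := by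
  have := (analyticAt_comp_line hG v).analyticOrderAt_deriv_add_one
  rw [analyticOrderAt_congr (deriv_comp_line_eventuallyEq hG v)] at this
  simpa [hz] using this.symm

theorem eventually_eq_zero_of_fderiv_eventually_eq_mul {G : E → ℂ} (hG : AnalyticAt ℂ G z)
    (hz : G z = 0) (h : ∀ v, ∃ q : E → ℂ, AnalyticAt ℂ q z ∧
      ∀ᶠ y in 𝓝 z, fderiv ℂ G y v = G y * q y) : ∀ᶠ y in 𝓝 z, G y = 0 := by
  refine eventually_eq_zero_of_forall_line hG fun v => analyticOrderAt_eq_top.1 ?_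
  obtain ⟨q, hq, hGq⟩ := h v
  have horder := analyticOrderAt_comp_line_eq hG hz v
  rw [analyticOrderAt_congr (f := fun t => fderiv ℂ G (z + t • v) v)
    ((tendsto_line_zero z v).eventually hGq),
    show (fun t : ℂ => G (z + t • v) * q (z + t • v)) =
      (fun t => G (z + t • v)) * fun t => q (z + t • v) from rfl,
    analyticOrderAt_mul (analyticAt_comp_line hG v) (analyticAt_comp_line hq v)]
    at horder
  by_contra hfin
  have hlt : analyticOrderAt (fun t : ℂ => G (z + t • v)) 0 + 1 ≤ _ :=
    (add_le_add_left le_self_add 1).trans horder.ge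
  exact ((ENat.add_one_le_iff hfin).1 hlt).false

theorem eventually_eq_zero_of_fderiv_apply_mem {C : Set (E → F)}
    (hC : ∀ G ∈ C, AnalyticAt ℂ G z ∧ G z = 0)
    (hd : ∀ G ∈ C, ∀ v, (fun y => fderiv ℂ G y v) ∈ C) {G : E → F} (hG : G ∈ C) :
    ∀ᶠ y in 𝓝 z, G y = 0 := by
  refine eventually_eq_zero_of_forall_line (hC G hG).1 fun v => analyticOrderAt_eq_top.1 ?_
  have hn (n : ℕ) : ∀ K ∈ C, (n : ℕ∞) ≤ analyticOrderAt (fun t : ℂ => K (z + t • v)) 0 := by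
    induction n with
    | zero => simp
    | succ n ih =>
      intro K hK
      rw [analyticOrderAt_comp_line_eq (hC K hK).1 (hC K hK).2, Nat.cast_succ]
      gcongr
      exact ih _ (hd K hK v)
  exact ENat.eq_top_iff_forall_ge.2 fun n => hn n G hG

theorem eventually_eq_zero_or_of_eventually_mul_eq_zero {A B : E → ℂ} (hA : AnalyticAt ℂ A z)
    (hB : AnalyticAt ℂ B z) (h : ∀ᶠ y in 𝓝 z, A y * B y = 0) :
    (∀ᶠ y in 𝓝 z, A y = 0) ∨ ∀ᶠ y in 𝓝 z, B y = 0 := by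
  let _ := NormedSpace.restrictScalars ℝ ℂ E
  obtain ⟨r, hr, hAB⟩ := Metric.eventually_nhds_iff_ball.1
    ((hA.eventually_analyticAt.and hB.eventually_analyticAt).and h)
  by_cases hz : ∀ y ∈ Metric.ball z r, A y = 0
  · exact .inl (Metric.eventually_nhds_iff_ball.2 ⟨r, hr, hz⟩)
  push Not at hz
  obtain ⟨y, hy, hAy⟩ := hz
  have hBy : B =ᶠ[𝓝 y] 0 := by
    filter_upwards [(hAB y hy).1.1.continuousAt.eventually_ne hAy,
      Metric.isOpen_ball.mem_nhds hy] with x hx hxr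
    exact (mul_eq_zero.1 (hAB x hxr).2).resolve_left hx
  exact .inr (Metric.eventually_nhds_iff_ball.2 ⟨r, hr,
    AnalyticOnNhd.eqOn_zero_of_preconnected_of_eventuallyEq_zero
      (fun x hx => (hAB x hx).1.2) Metric.isPreconnected_ball hy hBy⟩)

end Derivatives

section InverseFunction

variable {𝕜 E F : Type*} [NontriviallyNormedField 𝕜] [NormedAddCommGroup E] [NormedSpace 𝕜 E]
  [NormedAddCommGroup F] [NormedSpace 𝕜 F] [CompleteSpace E] [CompleteSpace F] {z : E}

theorem exists_analytic_openPartialHomeomorph {θ : E → F} (hθ : AnalyticAt 𝕜 θ z) (L : E ≃L[𝕜] F)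
    (hL : fderiv 𝕜 θ z = L) :
    ∃ e : OpenPartialHomeomorph E F, z ∈ e.source ∧ e = θ ∧
      AnalyticOnNhd 𝕜 e e.source ∧ AnalyticOnNhd 𝕜 e.symm e.target := by
  have hs : HasStrictFDerivAt θ (L : E →L[𝕜] F) z := hL ▸ hθ.hasStrictFDerivAt
  set R := hs.toOpenPartialHomeomorph θ
  have hz : z ∈ R.source := hs.mem_toOpenPartialHomeomorph_source
  set O : Set E := {y | AnalyticAt 𝕜 θ y} ∩ (R.source ∩ R ⁻¹' {w | AnalyticAt 𝕜 R.symm w})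
  have hO : IsOpen O := (isOpen_analyticAt 𝕜 θ).inter
    (R.continuousOn.isOpen_inter_preimage R.open_source (isOpen_analyticAt 𝕜 R.symm))
  refine ⟨R.restrOpen O hO, ⟨hz, hθ, hz, R.analyticAt_symm' hz hθ hL⟩, rfl,
    fun y hy => hy.2.1, fun y hy => ?_⟩
  have hsymm : AnalyticAt 𝕜 R.symm (R (R.symm y)) := ((R.restrOpen O hO).map_target hy).2.2.2
  rwa [show R (R.symm y) = y from (R.restrOpen O hO).right_inv hy] at hsymm

end InverseFunction

section Straightening

variable {𝕜 E : Type*} [NontriviallyNormedField 𝕜] [CompleteSpace 𝕜] [NormedAddCommGroup E]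
  [NormedSpace 𝕜 E] [FiniteDimensional 𝕜 E]

theorem exists_continuousLinearEquiv_apply_zero_eq {ℓ : E →L[𝕜] 𝕜} (hℓ : ℓ ≠ 0) :
    ∃ (k : ℕ) (A : E ≃L[𝕜] (Fin (k + 1) → 𝕜)), ∀ v, A v 0 = ℓ v := by
  obtain ⟨e, he⟩ : ∃ e, ℓ e = 1 := LinearMap.surjective (f := ℓ.toLinearMap)
    (by simpa [← ContinuousLinearMap.coe_inj] using hℓ) 1
  have hinv : Function.RightInverse (ContinuousLinearMap.toSpanSingleton 𝕜 e) ℓ := fun c => by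
    simp [he]
  let split := ContinuousLinearEquiv.equivOfRightInverse ℓ (.toSpanSingleton 𝕜 e) hinv
  let coord : ℓ.ker ≃L[𝕜] (Fin (Module.finrank 𝕜 ℓ.ker) → 𝕜) :=
    .ofFinrankEq (by simp)
  exact ⟨_, (split.trans ((ContinuousLinearEquiv.refl 𝕜 𝕜).prodCongr coord)).trans
    (Fin.consEquivL 𝕜 fun _ => 𝕜), fun v => by simp [split]⟩

theorem exists_analytic_openPartialHomeomorph_apply_zero_eq {G : E → 𝕜} {z : E}
    (hG : AnalyticAt 𝕜 G z) (hd : fderiv 𝕜 G z ≠ 0) :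
    ∃ (k : ℕ) (e : OpenPartialHomeomorph E (Fin (k + 1) → 𝕜)),
      Module.finrank 𝕜 E = k + 1 ∧ z ∈ e.source ∧
      (∀ y, e y 0 = G y) ∧ AnalyticOnNhd 𝕜 e e.source ∧ AnalyticOnNhd 𝕜 e.symm e.target := by
  have := FiniteDimensional.complete 𝕜 E
  obtain ⟨k, A, hA⟩ := exists_continuousLinearEquiv_apply_zero_eq hd
  let θ (y : E) : Fin (k + 1) → 𝕜 := A y + (G y - fderiv 𝕜 G z y) • Pi.single 0 1
  have hθ : AnalyticAt 𝕜 θ z :=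
    (A.analyticAt z).add ((hG.sub ((fderiv 𝕜 G z).analyticAt z)).smul analyticAt_const)
  have hθA : HasFDerivAt θ (A : E →L[𝕜] (Fin (k + 1) → 𝕜)) z := by
    have := A.hasFDerivAt.add ((hG.differentiableAt.hasFDerivAt.sub
      (fderiv 𝕜 G z).hasFDerivAt).smul_const (Pi.single 0 1 : Fin (k + 1) → 𝕜))
    rwa [sub_self, ContinuousLinearMap.zero_smulRight, add_zero] at this
  obtain ⟨e, hz, he, hea, hesa⟩ := exists_analytic_openPartialHomeomorph hθ A hθA.fderiv
  exact ⟨k, e, by simpa using A.toLinearEquiv.finrank_eq, hz, fun y => by simp [he, θ, hA],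
    hea, hesa⟩

end Straightening

namespace IsLocalModel

variable {X : Type*} [TopologicalSpace X] {H : (X → ℂ) → X → Prop} {n m : ℕ} {U V : Set X}
  {φ : X → Fin n → ℂ} {Ω : Set (Fin n → ℂ)} {x : X}

theorem mem_image_iff (h : IsLocalModel H n U φ Ω) : ∃ S : Set ((Fin n → ℂ) → ℂ), S.Finite ∧
    (∀ g ∈ S, AnalyticOnNhd ℂ g Ω) ∧ ∀ z, z ∈ φ '' U ↔ z ∈ Ω ∧ ∀ g ∈ S, g z = 0 := by
  obtain ⟨S, hS, hSa, hSe⟩ := h.image_analytic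
  exact ⟨S, hS, hSa, fun z => by rw [hSe, mem_ofPred_eq]⟩

theorem mem_ambient (h : IsLocalModel H n U φ Ω) (hx : x ∈ U) : φ x ∈ Ω := by
  obtain ⟨S, -, -, hS⟩ := h.mem_image_iff
  exact ((hS _).1 (mem_image_of_mem φ hx)).1

theorem continuousOn (h : IsLocalModel H n U φ Ω) : ContinuousOn φ U :=
  continuousOn_iff_continuous_domRestrict.2 h.isEmbedding.continuous

theorem injOn (h : IsLocalModel H n U φ Ω) : InjOn φ U :=
  injOn_iff_injective.2 h.isEmbedding.injective

theorem mem_nhds (h : IsLocalModel H n U φ Ω) (hx : x ∈ U) : U ∈ 𝓝 x :=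
  h.isOpen_source.mem_nhds hx

theorem continuousAt (h : IsLocalModel H n U φ Ω) (hx : x ∈ U) : ContinuousAt φ x :=
  h.continuousOn.continuousAt (h.mem_nhds hx)

theorem exists_isOpen_inter_eq (h : IsLocalModel H n U φ Ω) (hV : IsOpen V) :
    ∃ O : Set (Fin n → ℂ), IsOpen O ∧ U ∩ V = U ∩ φ ⁻¹' O := by
  obtain ⟨O, hO, hVO⟩ := h.isEmbedding.isOpen_iff.1 (hV.preimage continuous_subtype_val)
  exact ⟨O, hO, (Subtype.preimage_val_eq_preimage_val_iff U _ _).1 hVO.symm⟩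

theorem eventually_nhds_apply (h : IsLocalModel H n U φ Ω) (hx : x ∈ U) {P : X → Prop}
    (hP : ∀ᶠ y in 𝓝 x, P y) : ∀ᶠ z in 𝓝 (φ x), ∀ y ∈ U, φ y = z → P y := by
  obtain ⟨V, hVP, hV, hxV⟩ := eventually_nhds_iff.1 hP
  obtain ⟨O, hO, hVO⟩ := h.exists_isOpen_inter_eq hV
  have hxO : x ∈ U ∩ φ ⁻¹' O := hVO ▸ ⟨hx, hxV⟩
  filter_upwards [hO.mem_nhds hxO.2] with z hz y hy hyz
  have hyV : y ∈ U ∩ V := hVO ▸ ⟨hy, by rwa [mem_preimage, hyz]⟩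
  exact hVP y hyV.2

theorem restrict_preimage (h : IsLocalModel H n U φ Ω) {O : Set (Fin n → ℂ)} (hO : IsOpen O) :
    IsLocalModel H n (U ∩ φ ⁻¹' O) φ (Ω ∩ O) where
  isOpen_source := h.continuousOn.isOpen_inter_preimage h.isOpen_source hO
  isOpen_ambient := h.isOpen_ambient.inter hO
  isEmbedding := h.isEmbedding.comp (IsEmbedding.inclusion inter_subset_left)
  image_analytic := by
    obtain ⟨S, hS, hSa, hSe⟩ := h.image_analytic
    refine ⟨S, hS, fun g hg => (hSa g hg).mono inter_subset_left, ?_⟩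
    rw [image_inter_preimage, hSe]
    ext z
    simp only [mem_inter_iff, mem_ofPred_eq, and_right_comm]
  hol_iff x hx := h.hol_iff x hx.1

theorem exists_restrict (h : IsLocalModel H n U φ Ω) (hV : IsOpen V) :
    ∃ Ω', IsLocalModel H n (U ∩ V) φ Ω' := by
  obtain ⟨O, hO, hVO⟩ := h.exists_isOpen_inter_eq hV
  exact ⟨Ω ∩ O, hVO ▸ h.restrict_preimage hO⟩

theorem transport (h : IsLocalModel H n U φ Ω) {α : (Fin n → ℂ) → Fin m → ℂ}
    {β : (Fin m → ℂ) → Fin n → ℂ} {Ω' : Set (Fin m → ℂ)} (hΩ' : IsOpen Ω')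
    (hα : ∀ x ∈ U, AnalyticAt ℂ α (φ x)) (hβ : AnalyticOnNhd ℂ β Ω') (hβΩ : MapsTo β Ω' Ω)
    (hαβ : LeftInvOn α β Ω') (hαU : ∀ x ∈ U, α (φ x) ∈ Ω') (hβα : ∀ x ∈ U, β (α (φ x)) = φ x) :
    IsLocalModel H m U (fun x => α (φ x)) Ω' where
  isOpen_source := h.isOpen_source
  isOpen_ambient := hΩ'
  isEmbedding := by
    have hcont : Continuous (U.domRestrict fun x => α (φ x)) :=
      continuousOn_iff_continuous_domRestrict.1 fun x hx =>
        ((hα x hx).continuousAt.comp (h.continuousAt hx)).continuousWithinAt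
    have hφ : Ω'.domRestrict β ∘ (fun x : U => (⟨α (φ x), hαU x x.2⟩ : Ω')) = U.domRestrict φ :=
      funext fun x => hβα x x.2
    exact IsEmbedding.subtypeVal.comp <| IsEmbedding.of_comp (hcont.subtype_mk _)
      (continuousOn_iff_continuous_domRestrict.1 hβ.continuousOn) (hφ ▸ h.isEmbedding)
  image_analytic := by
    obtain ⟨S, hS, hSa, hSe⟩ := h.mem_image_iff
    refine ⟨(· ∘ β) '' S, hS.image _, ?_, ?_⟩
    · rintro _ ⟨g, hg, rfl⟩
      exact (hSa g hg).comp hβ hβΩ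
    · ext w
      simp only [mem_ofPred_eq, forall_mem_image, Function.comp_apply]
      constructor
      · rintro ⟨x, hx, rfl⟩
        exact ⟨hαU x hx, hβα x hx ▸ ((hSe _).1 (mem_image_of_mem φ hx)).2⟩
      · rintro ⟨hw, hwS⟩
        obtain ⟨x, hx, hxw⟩ := (hSe (β w)).2 ⟨hβΩ hw, hwS⟩
        exact ⟨x, hx, by simp only [hxw, hαβ hw]⟩
  hol_iff := by
    intro x hx u
    rw [h.hol_iff x hx]
    constructor
    · rintro ⟨G, hG, hu⟩
      refine ⟨G ∘ β, ((hβα x hx).symm ▸ hG).comp (hβ _ (hαU x hx)), ?_⟩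
      filter_upwards [hu, h.mem_nhds hx] with y hy hyU
      rw [hy, Function.comp_apply, hβα y hyU]
    · rintro ⟨G, hG, hu⟩
      exact ⟨G ∘ α, hG.comp (hα x hx), hu⟩

end IsLocalModel

theorem analyticAt_coordinate {ι : Type*} [Fintype ι] (i : ι) (z : ι → ℂ) :
    AnalyticAt ℂ (fun z : ι → ℂ => z i) z :=
  (ContinuousLinearMap.proj (R := ℂ) (φ := fun _ : ι => ℂ) i).analyticAt z

theorem analyticAt_cons_zero {n : ℕ} (w : Fin n → ℂ) :
    AnalyticAt ℂ (fun w : Fin n → ℂ => (Fin.cons 0 w : Fin (n + 1) → ℂ)) w := by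
  refine analyticAt_pi_iff.2 (Fin.cases ?_ fun j => ?_)
  · simpa only [Fin.cons_zero] using analyticAt_const
  · simpa only [Fin.cons_succ] using analyticAt_coordinate j w

theorem analyticAt_tail {n : ℕ} (z : Fin (n + 1) → ℂ) :
    AnalyticAt ℂ (fun z : Fin (n + 1) → ℂ => (Fin.tail z : Fin n → ℂ)) z :=
  analyticAt_pi_iff.2 fun j => analyticAt_coordinate j.succ z

theorem analyticAt_fderiv_apply {E F : Type*} [NormedAddCommGroup E] [NormedSpace ℂ E]
    [NormedAddCommGroup F] [NormedSpace ℂ F] [CompleteSpace F] {G : E → F} {z : E}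
    (hG : AnalyticAt ℂ G z) (v : E) : AnalyticAt ℂ (fun y => fderiv ℂ G y v) z :=
  ((ContinuousLinearMap.apply ℂ F v).analyticAt _).comp hG.fderiv

namespace IsLocalModel

variable {X : Type*} [TopologicalSpace X] {H : (X → ℂ) → X → Prop} {n : ℕ} {U : Set X}
  {φ : X → Fin n → ℂ} {Ω : Set (Fin n → ℂ)} {x : X}

/-- `φ` is a *minimal embedding* at `x`: the functions vanishing on its image have no linear term
at `φ x`. For a local model `φ` this says that `n` is the dimension of the Zariski tangent space
of `X` at `x`. -/
def IsMinimalAt (φ : X → Fin n → ℂ) (x : X) : Prop :=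
  ∀ G : (Fin n → ℂ) → ℂ, AnalyticAt ℂ G (φ x) → (∀ᶠ y in 𝓝 x, G (φ y) = 0) →
    fderiv ℂ G (φ x) = 0

theorem exists_lt_of_not_isMinimalAt (h : IsLocalModel H n U φ Ω) (hx : x ∈ U)
    (hφ : ¬ IsMinimalAt φ x) : ∃ k < n, ∃ (V : Set X) (ψ : X → Fin k → ℂ) (Θ : Set (Fin k → ℂ)),
      x ∈ V ∧ V ⊆ U ∧ IsLocalModel H k V ψ Θ := by
  simp only [IsMinimalAt, not_forall] at hφ
  obtain ⟨G, hG, h0, hd⟩ := hφ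
  obtain ⟨k, e, hk, hxe, he0, he, he'⟩ := exists_analytic_openPartialHomeomorph_apply_zero_eq hG hd
  obtain rfl : n = k + 1 := by rw [← hk, Module.finrank_fin_fun]
  obtain ⟨W, hWG, hW, hxW⟩ := eventually_nhds_iff.1 h0
  obtain ⟨Ω₁, h₁⟩ := h.exists_restrict hW
  have h₂ := h₁.restrict_preimage e.open_source
  set Ω₂ := Ω₁ ∩ e.source
  have hcons : ∀ y ∈ U ∩ W, (Fin.cons 0 (Fin.tail (e (φ y))) : Fin (k + 1) → ℂ) = e (φ y) :=
    fun y hy => by rw [← hWG y hy.2, ← he0, Fin.cons_self_tail]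
  have hopen : IsOpen (e '' Ω₂) :=
    e.isOpen_image_of_subset_source h₂.isOpen_ambient inter_subset_right
  have htarget : ∀ z ∈ e '' Ω₂, z ∈ e.target ∧ e.symm z ∈ Ω₂ := by
    rintro _ ⟨z, hz, rfl⟩
    exact ⟨e.map_source hz.2, (e.left_inv hz.2).symm ▸ hz⟩
  refine ⟨k, k.lt_succ_self, U ∩ W ∩ φ ⁻¹' e.source, _, (fun w => Fin.cons 0 w) ⁻¹' (e '' Ω₂),
    ⟨⟨hx, hxW⟩, hxe⟩, fun y hy => hy.1.1, h₂.transport (α := fun z => Fin.tail (e z))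
    (β := fun w => e.symm (Fin.cons 0 w)) ?_ ?_ ?_ ?_ ?_ ?_ ?_⟩
  · exact hopen.preimage <|
      continuous_iff_continuousAt.2 fun w => (analyticAt_cons_zero w).continuousAt
  · exact fun y hy => (analyticAt_tail _).comp (he _ hy.2)
  · exact fun w hw => (he' _ (htarget _ hw).1).comp (analyticAt_cons_zero w)
  · exact fun w hw => (htarget _ hw).2
  · exact fun w hw => by simp only [e.right_inv (htarget _ hw).1, Fin.tail_cons]
  · exact fun y hy => by
      simpa only [mem_preimage, hcons y hy.1] using mem_image_of_mem e (h₂.mem_ambient hy)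
  · exact fun y hy => by simp only [hcons y hy.1, e.left_inv hy.2]

theorem image_mem_nhds_of_isMinimalAt (h : IsLocalModel H n U φ Ω)
    (hφ : ∀ y ∈ U, IsMinimalAt φ y) (hx : x ∈ U) :
    φ '' U ∈ 𝓝 (φ x) := by
  set C : Set ((Fin n → ℂ) → ℂ) := {G | ∀ y ∈ U, AnalyticAt ℂ G (φ y) ∧ G (φ y) = 0}
  have hCderiv : ∀ G ∈ C, ∀ v, (fun z => fderiv ℂ G z v) ∈ C := fun G hG v y hy => by
    have hGy : fderiv ℂ G (φ y) = 0 := hφ y hy G (hG y hy).1 <| by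
      filter_upwards [h.mem_nhds hy] with y' hy' using (hG y' hy').2
    exact ⟨analyticAt_fderiv_apply (hG y hy).1 v, by simp only [hGy, zero_apply]⟩
  obtain ⟨S, hS, hSa, hSe⟩ := h.mem_image_iff
  have hSC : S ⊆ C := fun g hg y hy =>
    have hy' := (hSe _).1 (mem_image_of_mem φ hy)
    ⟨hSa g hg _ hy'.1, hy'.2 g hg⟩
  have hS0 : ∀ᶠ z in 𝓝 (φ x), ∀ g ∈ S, g z = 0 := (eventually_all_finite hS).2 fun g hg =>
    eventually_eq_zero_of_fderiv_apply_mem (fun G (hG : G ∈ C) => hG x hx) hCderiv (hSC hg)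
  filter_upwards [h.isOpen_ambient.mem_nhds (h.mem_ambient hx), hS0] with z hz hz0
  exact (hSe z).2 ⟨hz, hz0⟩

end IsLocalModel

namespace ComplexSpace

section Germs

variable {X : Type*} [TopologicalSpace X] [ComplexSpace X] {x : X} {u v : X → ℂ}

theorem HolAt.congr (hu : HolAt u x) (h : v =ᶠ[𝓝 x] u) : HolAt v x := by
  obtain ⟨n, U, φ, Ω, hx, hm⟩ := exists_localModel x
  obtain ⟨G, hG, huG⟩ := (hm.hol_iff x hx u).1 hu
  exact (hm.hol_iff x hx v).2 ⟨G, hG, h.trans huG⟩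

theorem HolAt.continuousAt (hu : HolAt u x) : ContinuousAt u x := by
  obtain ⟨n, U, φ, Ω, hx, hm⟩ := exists_localModel x
  obtain ⟨G, hG, huG⟩ := (hm.hol_iff x hx u).1 hu
  exact (hG.continuousAt.comp (hm.continuousAt hx)).congr huG.symm

theorem HolAt.eventually (hu : HolAt u x) : ∀ᶠ y in 𝓝 x, HolAt u y := by
  obtain ⟨n, U, φ, Ω, hx, hm⟩ := exists_localModel x
  obtain ⟨G, hG, huG⟩ := (hm.hol_iff x hx u).1 hu
  filter_upwards [hm.mem_nhds hx, huG.eventually_nhds,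
    (hm.continuousAt hx).eventually hG.eventually_analyticAt] with y hy huGy hGy
  exact (hm.hol_iff y hy u).2 ⟨G, hGy, huGy⟩

theorem HolAt.pow (hu : HolAt u x) (k : ℕ) : HolAt (fun y => u y ^ k) x := by
  induction k with
  | zero => simpa only [pow_zero] using holAt_const 1 x
  | succ k ih => simpa only [pow_succ] using ih.mul hu

end Germs

end ComplexSpace

namespace IsLocalModel

open ComplexSpace

variable {X : Type*} [TopologicalSpace X] [ComplexSpace X] {n m : ℕ} {U : Set X}
  {φ : X → Fin n → ℂ} {Ω : Set (Fin n → ℂ)} {x : X}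

theorem holAt_comp (h : IsLocalModel HolAt n U φ Ω) (hx : x ∈ U) {G : (Fin n → ℂ) → ℂ}
    (hG : AnalyticAt ℂ G (φ x)) : HolAt (fun y => G (φ y)) x :=
  (h.hol_iff x hx _).2 ⟨G, hG, EventuallyEq.rfl⟩

theorem holAt_coordinate (h : IsLocalModel HolAt n U φ Ω) (hx : x ∈ U) (i : Fin n) :
    HolAt (fun y => φ y i) x :=
  h.holAt_comp hx (analyticAt_coordinate i _)

theorem exists_analyticAt_comp_eq (h : IsLocalModel HolAt n U φ Ω) (hx : x ∈ U)
    {u : X → Fin m → ℂ} (hu : ∀ i, HolAt (fun y => u y i) x) :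
    ∃ K : (Fin n → ℂ) → Fin m → ℂ, AnalyticAt ℂ K (φ x) ∧ ∀ᶠ y in 𝓝 x, u y = K (φ y) := by
  choose K hK huK using fun i => (h.hol_iff x hx _).1 (hu i)
  exact ⟨fun z i => K i z, analyticAt_pi_iff.2 hK,
    (eventually_all.2 huK).mono fun y hy => funext hy⟩

theorem exists_isCoordinates_of_image_mem_nhds (h : IsLocalModel HolAt n U φ Ω) (hx : x ∈ U)
    (hn : φ '' U ∈ 𝓝 (φ x)) : ∃ V ⊆ U, x ∈ V ∧ IsCoordinates n V φ := by
  have h' := h.restrict_preimage (isOpen_interior (s := φ '' U))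
  have himage : φ '' (U ∩ φ ⁻¹' interior (φ '' U)) = interior (φ '' U) := by
    rw [image_inter_preimage, inter_eq_right.2 interior_subset]
  refine ⟨U ∩ φ ⁻¹' interior (φ '' U), inter_subset_left, ⟨hx, mem_interior_iff_mem_nhds.2 hn⟩, ?_⟩
  rw [IsCoordinates, himage]
  exact ⟨h'.isOpen_source, isOpen_interior, h'.isEmbedding,
    ⟨∅, finite_empty, by simp, by simp [himage]⟩, h'.hol_iff⟩

end IsLocalModel

namespace ComplexSpace.IsCoordinates

variable {X : Type*} [TopologicalSpace X] [ComplexSpace X] {n : ℕ} {U V : Set X}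
  {φ : X → Fin n → ℂ} {x : X}

theorem isLocalModel (h : IsCoordinates n U φ) : IsLocalModel HolAt n U φ (φ '' U) := h

theorem mem_nhds (h : IsCoordinates n U φ) (hx : x ∈ U) : U ∈ 𝓝 x :=
  h.isLocalModel.mem_nhds hx

theorem restrict (h : IsCoordinates n U φ) (hV : IsOpen V) : IsCoordinates n (U ∩ V) φ := by
  obtain ⟨O, hO, hVO⟩ := h.isLocalModel.exists_isOpen_inter_eq hV
  rw [hVO, IsCoordinates, image_inter_preimage]
  exact h.isLocalModel.restrict_preimage hO

theorem image_mem_nhds (h : IsCoordinates n U φ) (hx : x ∈ U) : φ '' U ∈ 𝓝 (φ x) :=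
  h.isOpen_ambient.mem_nhds (mem_image_of_mem φ hx)

theorem eventually_comp_iff (h : IsCoordinates n U φ) (hx : x ∈ U) {P : (Fin n → ℂ) → Prop} :
    (∀ᶠ y in 𝓝 x, P (φ y)) ↔ ∀ᶠ z in 𝓝 (φ x), P z := by
  refine ⟨fun hP => ?_, fun hP => (h.isLocalModel.continuousAt hx).eventually hP⟩
  filter_upwards [h.isLocalModel.eventually_nhds_apply hx hP, h.image_mem_nhds hx]
    with z hz ⟨y, hy, hyz⟩
  exact hyz ▸ hz y hy hyz

theorem exists_apply_zero_eq (h : IsCoordinates n U φ) (hx : x ∈ U) {G : (Fin n → ℂ) → ℂ}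
    (hG : AnalyticAt ℂ G (φ x)) (hd : fderiv ℂ G (φ x) ≠ 0) :
    ∃ (k : ℕ) (V : Set X) (ψ : X → Fin (k + 1) → ℂ),
      x ∈ V ∧ IsCoordinates (k + 1) V ψ ∧ ∀ y, ψ y 0 = G (φ y) := by
  obtain ⟨k, e, -, hxe, he0, he, he'⟩ := exists_analytic_openPartialHomeomorph_apply_zero_eq hG hd
  have h' := h.isLocalModel.restrict_preimage e.open_source
  have himage : φ '' U ∩ e.source = φ '' (U ∩ φ ⁻¹' e.source) := (image_inter_preimage _ _ _).symm
  refine ⟨k, U ∩ φ ⁻¹' e.source, fun y => e (φ y), ⟨hx, hxe⟩, ?_, fun y => he0 _⟩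
  rw [IsCoordinates, ← image_image e φ, ← himage]
  have hsource : φ '' U ∩ e.source ⊆ e.source := inter_subset_right
  refine h'.transport (β := e.symm) (e.isOpen_image_of_subset_source h'.isOpen_ambient hsource)
    (fun y hy => he _ hy.2) (fun w hw => he' w (e.mapsTo.mono_left hsource |>.image_subset hw))
    ?_ (e.rightInvOn.mono (e.mapsTo.mono_left hsource).image_subset)
    (fun y hy => mem_image_of_mem e (h'.mem_ambient hy)) fun y hy => e.left_inv hy.2
  rintro _ ⟨z, hz, rfl⟩
  rwa [e.left_inv hz.2]

end ComplexSpace.IsCoordinates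

namespace IsLocalModel

variable {X : Type*} [TopologicalSpace X] {H : (X → ℂ) → X → Prop} {n m : ℕ} {U : Set X}
  {φ : X → Fin n → ℂ} {Ω : Set (Fin n → ℂ)} {x : X}

theorem IsMinimalAt.fderiv_eq_zero (hφ : IsMinimalAt φ x) {G : (Fin n → ℂ) → Fin m → ℂ}
    (hG : AnalyticAt ℂ G (φ x)) (h0 : ∀ᶠ y in 𝓝 x, G (φ y) = 0) : fderiv ℂ G (φ x) = 0 := by
  rw [fderiv_pi fun i => (analyticAt_pi_iff.1 hG i).differentiableAt]
  ext v i
  rw [ContinuousLinearMap.pi_apply,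
    hφ _ (analyticAt_pi_iff.1 hG i) (h0.mono fun y => congrFun (a := i))]
  rfl

theorem exists_isMinimalAt (h : IsLocalModel H n U φ Ω) (hx : x ∈ U) :
    ∃ (k : ℕ) (V : Set X) (ψ : X → Fin k → ℂ) (Θ : Set (Fin k → ℂ)),
      x ∈ V ∧ IsLocalModel H k V ψ Θ ∧ IsMinimalAt ψ x := by
  induction n using Nat.strong_induction_on generalizing U with
  | _ n ih =>
    by_cases hmin : IsMinimalAt φ x
    · exact ⟨n, U, φ, Ω, hx, h, hmin⟩
    · obtain ⟨k, hk, V, ψ, Θ, hxV, -, hm⟩ := h.exists_lt_of_not_isMinimalAt hx hmin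
      exact ih k hk hm hxV

end IsLocalModel

namespace ComplexSpace

section Density

variable {X : Type*} [TopologicalSpace X] [ComplexSpace X]

theorem _root_.IsLocalModel.nonempty_inter_regularLocus {n : ℕ} {U : Set X} {φ : X → Fin n → ℂ}
    {Ω : Set (Fin n → ℂ)} (h : IsLocalModel HolAt n U φ Ω) (hU : U.Nonempty) :
    (U ∩ regularLocus X).Nonempty := by
  induction n using Nat.strong_induction_on generalizing U with
  | _ n ih =>
    by_cases hmin : ∀ y ∈ U, IsLocalModel.IsMinimalAt φ y
    · obtain ⟨x, hx⟩ := hU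
      obtain ⟨V, -, hxV, hV⟩ := h.exists_isCoordinates_of_image_mem_nhds hx
        (h.image_mem_nhds_of_isMinimalAt hmin hx)
      exact ⟨x, hx, n, V, φ, hxV, hV⟩
    · push Not at hmin
      obtain ⟨y, hy, hymin⟩ := hmin
      obtain ⟨k, hk, V, ψ, Θ, hyV, hVU, hm⟩ := h.exists_lt_of_not_isMinimalAt hy hymin
      exact (ih k hk hm ⟨y, hyV⟩).mono (inter_subset_inter_left _ hVU)

theorem dense_regularLocus : Dense (regularLocus X) := by
  refine dense_iff_inter_open.2 fun O hO ⟨x, hxO⟩ => ?_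
  obtain ⟨n, U, φ, Ω, hxU, h⟩ := exists_localModel x
  obtain ⟨Ω', h'⟩ := h.exists_restrict hO
  exact (h'.nonempty_inter_regularLocus ⟨x, hxU, hxO⟩).mono
    (inter_subset_inter_left _ inter_subset_right)

end Density

end ComplexSpace

section Append

variable {n m : ℕ}

/-- The identification `ℂⁿ × ℂᵐ = ℂⁿ⁺ᵐ` as a continuous linear map; its restrictions to the two
factors are the partial derivatives of `Fin.append`. -/
def appendL (n m : ℕ) : (Fin n → ℂ) × (Fin m → ℂ) →L[ℂ] (Fin (n + m) → ℂ) where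
  toFun q := Fin.append q.1 q.2
  map_add' p q := by
    funext i
    refine Fin.addCases (fun i => ?_) (fun i => ?_) i <;> simp
  map_smul' c q := by
    funext i
    refine Fin.addCases (fun i => ?_) (fun i => ?_) i <;> simp
  cont := (Fin.appendHomeomorph n m).continuous

theorem hasFDerivAt_append_left (a : Fin n → ℂ) (b : Fin m → ℂ) :
    HasFDerivAt (fun z => (Fin.append z b : Fin (n + m) → ℂ))
      ((appendL n m).comp (.inl ℂ _ _)) a :=
  (appendL n m).hasFDerivAt.comp a (hasFDerivAt_prodMk_left a b)

theorem hasFDerivAt_append_right (a : Fin n → ℂ) (b : Fin m → ℂ) :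
    HasFDerivAt (fun z => (Fin.append a z : Fin (n + m) → ℂ))
      ((appendL n m).comp (.inr ℂ _ _)) b :=
  (appendL n m).hasFDerivAt.comp b (hasFDerivAt_prodMk_right a b)

theorem analyticAt_append_left (a : Fin n → ℂ) (b : Fin m → ℂ) :
    AnalyticAt ℂ (fun z => (Fin.append z b : Fin (n + m) → ℂ)) a :=
  (ComplexSpace.analyticAt_append (a, b)).comp (f := fun z => (z, b))
    (analyticAt_id.prod analyticAt_const)

theorem analyticAt_append_right (a : Fin n → ℂ) (b : Fin m → ℂ) :
    AnalyticAt ℂ (fun z => (Fin.append a z : Fin (n + m) → ℂ)) b :=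
  (ComplexSpace.analyticAt_append (a, b)).comp (analyticAt_const.prod analyticAt_id)

end Append

namespace IsLocalModel

variable {X : Type*} [TopologicalSpace X] {Y : Type*} [TopologicalSpace Y] {n m : ℕ}

theorem IsMinimalAt.prod {φ : X → Fin n → ℂ} {x : X} (hφ : IsMinimalAt φ x)
    {ψ : Y → Fin m → ℂ} {y : Y} (hψ : IsMinimalAt ψ y) :
    IsMinimalAt (fun p : X × Y => Fin.append (φ p.1) (ψ p.2)) (x, y) := by
  intro G hG h0
  have hG' := hG.differentiableAt.hasFDerivAt
  have hleft : (fderiv ℂ G (Fin.append (φ x) (ψ y))).comp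
      ((appendL n m).comp (.inl ℂ _ _)) = 0 := by
    rw [← (hG'.comp (f := fun z => Fin.append z (ψ y)) (φ x)
      (hasFDerivAt_append_left (φ x) (ψ y))).fderiv]
    exact hφ _ (hG.comp (f := fun z => Fin.append z (ψ y))
      (analyticAt_append_left (φ x) (ψ y)))
      ((Continuous.prodMk_left y).continuousAt.eventually h0)
  have hright : (fderiv ℂ G (Fin.append (φ x) (ψ y))).comp
      ((appendL n m).comp (.inr ℂ _ _)) = 0 := by
    rw [← (hG'.comp (ψ y) (hasFDerivAt_append_right (φ x) (ψ y))).fderiv]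
    exact hψ _ (hG.comp (analyticAt_append_right (φ x) (ψ y)))
      ((Continuous.prodMk_right x).continuousAt.eventually h0)
  ext1 v
  have hv : v = appendL n m (ContinuousLinearMap.inl ℂ _ _ (ComplexSpace.splitFst v)) +
      appendL n m (ContinuousLinearMap.inr ℂ _ _ (ComplexSpace.splitSnd v)) := by
    rw [← map_add, ContinuousLinearMap.inl_apply, ContinuousLinearMap.inr_apply, Prod.mk_add_mk,
      add_zero, zero_add]
    exact (ComplexSpace.append_split v).symm
  rw [hv, map_add]
  simpa using congr($hleft (ComplexSpace.splitFst v) + $hright (ComplexSpace.splitSnd v))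

end IsLocalModel

namespace ComplexSpace

section Product

variable {X : Type*} [TopologicalSpace X] [ComplexSpace X] {n m : ℕ} {U : Set X}
  {φ : X → Fin n → ℂ} {Ω : Set (Fin n → ℂ)} {x : X}

theorem _root_.IsLocalModel.image_mem_nhds_of_mem_regularLocus (h : IsLocalModel HolAt n U φ Ω)
    (hx : x ∈ U) (hφ : IsLocalModel.IsMinimalAt φ x) (hreg : x ∈ regularLocus X) :
    φ '' U ∈ 𝓝 (φ x) := by
  obtain ⟨N, W, Φ, hW, hΦ⟩ := hreg
  obtain ⟨K, hK, hΦK⟩ :=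
    h.exists_analyticAt_comp_eq hx fun i => hΦ.isLocalModel.holAt_coordinate hW i
  obtain ⟨J, hJ, hφJ⟩ :=
    hΦ.isLocalModel.exists_analyticAt_comp_eq hW fun i => h.holAt_coordinate hx i
  have hΦx : Φ x = K (φ x) := hΦK.self_of_nhds
  have hJ' : AnalyticAt ℂ J (K (φ x)) := hΦx ▸ hJ
  have hid : fderiv ℂ (fun w => w - J (K w)) (φ x) = 0 := by
    refine hφ.fderiv_eq_zero (analyticAt_id.sub (hJ'.comp hK)) ?_
    filter_upwards [hΦK, hφJ] with y hy hy'
    rw [← hy, ← hy', sub_self]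
  have hJK := (hasFDerivAt_id (𝕜 := ℂ) (φ x)).sub
    (hJ'.differentiableAt.hasFDerivAt.comp _ hK.differentiableAt.hasFDerivAt)
  have hsurj : (fderiv ℂ J (Φ x)).range = ⊤ := LinearMap.range_eq_top.2 fun v =>
    ⟨fderiv ℂ K (φ x) v, by
      rw [hΦx]
      exact (sub_eq_zero.1 (congr($(hJK.fderiv.symm.trans hid) v))).symm⟩
  change ∀ᶠ w in 𝓝 (φ x), w ∈ φ '' U
  rw [show φ x = J (Φ x) from hφJ.self_of_nhds, ← hJ.hasStrictFDerivAt.map_nhds_eq_of_surj hsurj,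
    eventually_map, ← hΦ.eventually_comp_iff hW]
  filter_upwards [hφJ, h.mem_nhds hx] with y hy hyU using ⟨y, hyU, hy⟩

variable {Y : Type*} [TopologicalSpace Y] [ComplexSpace Y]

theorem _root_.IsLocalModel.prod_holAt (h : IsLocalModel HolAt n U φ Ω) {V : Set Y}
    {ψ : Y → Fin m → ℂ} {Θ : Set (Fin m → ℂ)} (k : IsLocalModel HolAt m V ψ Θ) :
    IsLocalModel (HolAt (X := X × Y)) (n + m) (U ×ˢ V) (fun p => Fin.append (φ p.1) (ψ p.2))
      {z | splitFst z ∈ Ω ∧ splitSnd z ∈ Θ} :=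
  ComplexSpace.IsLocalModel.prod h k

theorem mem_regularLocus_of_prodMk_mem {y : Y} (hxy : (x, y) ∈ regularLocus (X × Y)) :
    x ∈ regularLocus X := by
  obtain ⟨_, _, _, _, hxU₀, h₀⟩ := exists_localModel x
  obtain ⟨_, _, _, _, hyV₀, k₀⟩ := exists_localModel y
  obtain ⟨n, U, φ, Ω, hxU, h, hφ⟩ := h₀.exists_isMinimalAt hxU₀
  obtain ⟨m, V, ψ, Θ, hyV, k, hψ⟩ := k₀.exists_isMinimalAt hyV₀
  have hnhds := (h.prod_holAt k).image_mem_nhds_of_mem_regularLocus (mk_mem_prod hxU hyV)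
    (hφ.prod hψ) hxy
  have hφU : φ '' U ∈ 𝓝 (φ x) := by
    filter_upwards [(analyticAt_append_left (φ x) (ψ y)).continuousAt hnhds]
    rintro z ⟨p, hp, hpz⟩
    exact ⟨p.1, hp.1, by simpa only [splitFst_append] using congr(splitFst $hpz)⟩
  obtain ⟨U', -, hxU', hU'⟩ := h.exists_isCoordinates_of_image_mem_nhds hxU hφU
  exact ⟨n, U', φ, hxU', hU'⟩

end Product

end ComplexSpace

namespace ComplexSpace

section Identity

variable {X : Type*} [TopologicalSpace X] [ComplexSpace X] {x : X} {A : Set X}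

theorem HolAt.eventually_eq_zero_of_frequently {u : X → ℂ} (hu : HolAt u x)
    (hx : x ∈ regularLocus X) (h0 : ∃ᶠ y in 𝓝 x, ∀ᶠ y' in 𝓝 y, u y' = 0) :
    ∀ᶠ y in 𝓝 x, u y = 0 := by
  obtain ⟨n, U, φ, hxU, hφ⟩ := hx
  obtain ⟨G, hG, huG⟩ := (hφ.hol_iff x hxU u).1 hu
  obtain ⟨r, hr, hGr⟩ := Metric.eventually_nhds_iff_ball.1 hG.eventually_analyticAt
  have hball : φ ⁻¹' Metric.ball (φ x) r ∈ 𝓝 x :=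
    hφ.isLocalModel.continuousAt hxU (Metric.ball_mem_nhds _ hr)
  obtain ⟨y, hy0, hyr, hyU, hyG⟩ := (h0.and_eventually ((eventually_mem_set.2 hball).and
    ((eventually_mem_set.2 (hφ.mem_nhds hxU)).and huG.eventually_nhds))).exists
  have hGy : G =ᶠ[𝓝 (φ y)] 0 := by
    refine (hφ.eventually_comp_iff hyU).1 ?_
    filter_upwards [hy0, hyG] with y' h0 hG using hG.symm.trans h0
  have hconn : IsPreconnected (Metric.ball (φ x) r) := by
    let _ := NormedSpace.restrictScalars ℝ ℂ (Fin n → ℂ)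
    exact Metric.isPreconnected_ball
  have hGball := AnalyticOnNhd.eqOn_zero_of_preconnected_of_eventuallyEq_zero hGr hconn hyr hGy
  filter_upwards [huG, hball] with y' hu hr using hu.trans (hGball hr)

theorem IsHolomorphicMap.isAnalyticSubset_preimage {Y : Type*} [TopologicalSpace Y]
    [ComplexSpace Y] {f : X → Y} (hf : IsHolomorphicMap f) {D : Set Y} (hD : IsAnalyticSubset D) :
    IsAnalyticSubset (f ⁻¹' D) := by
  intro x
  obtain ⟨U, S, hU, hx, hS, hSh, hDU⟩ := hD (f x)
  refine ⟨f ⁻¹' U, (fun u y => u (f y)) '' S, hU.preimage hf.continuous, hx, hS.image _, ?_, ?_⟩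
  · rintro _ ⟨u, hu, rfl⟩ y hy
    exact hf.holAt_comp y u (hSh u hu _ hy)
  · ext y
    simpa using congr(f y ∈ $hDU)

theorem IsAnalyticSubset.isClosed (hA : IsAnalyticSubset A) : IsClosed A := by
  refine isClosed_of_closure_subset fun x hx => ?_
  obtain ⟨U, S, hU, hxU, -, hSh, hAU⟩ := hA x
  have hx0 : ∀ u ∈ S, u x = 0 := fun u hu => by
    by_contra hne
    obtain ⟨y, hy, hyA⟩ := mem_closure_iff_nhds.1 hx _
      (inter_mem ((hSh u hu x hxU).continuousAt.eventually_ne hne) (hU.mem_nhds hxU))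
    exact hy.1 ((hAU.subset ⟨hyA, hy.2⟩).2 u hu)
  exact (hAU.superset ⟨hxU, hx0⟩).1

theorem IsAnalyticSubset.mem_nhds_of_mem_closure_interior (hA : IsAnalyticSubset A)
    (hx : x ∈ regularLocus X) (hxA : x ∈ closure (interior A)) : A ∈ 𝓝 x := by
  obtain ⟨U, S, hU, hxU, hS, hSh, hAU⟩ := hA x
  have hfreq : ∃ᶠ y in 𝓝 x, y ∈ interior A ∧ y ∈ U :=
    (mem_closure_iff_frequently.1 hxA).and_eventually (hU.mem_nhds hxU)
  have hS0 : ∀ u ∈ S, ∀ᶠ y in 𝓝 x, u y = 0 := fun u hu => by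
    refine (hSh u hu x hxU).eventually_eq_zero_of_frequently hx (hfreq.mono fun y hy => ?_)
    filter_upwards [mem_interior_iff_mem_nhds.1 hy.1, hU.mem_nhds hy.2] with y' hyA hyU
    exact (hAU.subset ⟨hyA, hyU⟩).2 u hu
  filter_upwards [hU.mem_nhds hxU, (eventually_all_finite hS).2 hS0] with y hyU hy0
  exact (hAU.superset ⟨hyU, hy0⟩).1

theorem IsAnalyticSubset.eq_univ (hA : IsAnalyticSubset A)
    (hX : IsPreconnected (regularLocus X)) (hxA : A ∈ 𝓝 x) : A = univ := by
  have hne : (regularLocus X ∩ interior A).Nonempty :=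
    (dense_regularLocus.inter_open_nonempty _ isOpen_interior
      ⟨x, mem_interior_iff_mem_nhds.2 hxA⟩).mono fun y hy => ⟨hy.2, hy.1⟩
  have hreg : regularLocus X ⊆ interior A :=
    hX.subset_of_closure_inter_subset isOpen_interior hne fun y hy =>
      mem_interior_iff_mem_nhds.2 (hA.mem_nhds_of_mem_closure_interior hy.2 hy.1)
  exact hA.isClosed.closure_eq.symm.trans
    (dense_regularLocus.mono (hreg.trans interior_subset)).closure_eq

end Identity

end ComplexSpace

namespace ComplexSpace.IsCoordinates

section Hypersurface

variable {X : Type*} [TopologicalSpace X] [ComplexSpace X] {n : ℕ} {U : Set X}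
  {φ : X → Fin (n + 1) → ℂ} {x : X} {u v w : X → ℂ}

theorem not_eventually_apply_zero_eq_zero (h : IsCoordinates (n + 1) U φ) (hx : x ∈ U) :
    ¬∀ᶠ y in 𝓝 x, φ y 0 = 0 := by
  intro h0
  let ℓ := ContinuousLinearMap.proj (R := ℂ) (φ := fun _ : Fin (n + 1) => ℂ) 0
  have hℓ : ⇑ℓ =ᶠ[𝓝 (φ x)] fun _ => 0 :=
    (h.eventually_comp_iff hx (P := fun z => z 0 = 0)).1 h0
  have hfderiv : ℓ = 0 := by
    rw [← ℓ.fderiv (x := φ x), hℓ.fderiv_eq, fderiv_const_apply]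
  simpa [ℓ] using congr($hfderiv (Pi.single 0 1))

theorem eventually_eq_zero_of_pow_mul_eq_zero (h : IsCoordinates (n + 1) U φ) (hx : x ∈ U)
    (hv : HolAt v x) {j : ℕ} (h0 : ∀ᶠ y in 𝓝 x, φ y 0 ^ j * v y = 0) : ∀ᶠ y in 𝓝 x, v y = 0 := by
  obtain ⟨G, hG, hvG⟩ := (h.hol_iff x hx v).1 hv
  have hGj : ∀ᶠ z in 𝓝 (φ x), z 0 ^ j * G z = 0 := by
    refine (h.eventually_comp_iff hx).1 ?_
    filter_upwards [h0, hvG] with y hy hvy using hvy ▸ hy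
  rcases eventually_eq_zero_or_of_eventually_mul_eq_zero ((analyticAt_coordinate 0 _).pow j) hG hGj
    with hpow | hG0
  · refine absurd ?_ (h.not_eventually_apply_zero_eq_zero hx)
    filter_upwards [(h.eventually_comp_iff hx).2 hpow] with y hy using eq_zero_of_pow_eq_zero hy
  · filter_upwards [hvG, (h.eventually_comp_iff hx).2 hG0] with y hvy hy using hvy.trans hy

theorem exists_eq_apply_zero_mul (h : IsCoordinates (n + 1) U φ) (hx : x ∈ U) (hx0 : φ x 0 = 0)
    (hu : HolAt u x) (h0 : ∀ᶠ y in 𝓝 x, φ y 0 = 0 → u y = 0) :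
    ∃ v : X → ℂ, HolAt v x ∧ ∀ᶠ y in 𝓝 x, u y = φ y 0 * v y := by
  obtain ⟨G, hG, huG⟩ := (h.hol_iff x hx u).1 hu
  have hG0 : ∀ᶠ z in 𝓝 (φ x), z 0 = 0 → G z = 0 := by
    refine (h.eventually_comp_iff hx).1 ?_
    filter_upwards [h0, huG] with y hy huy using huy ▸ hy
  let ℓ := ContinuousLinearMap.proj (R := ℂ) (φ := fun _ : Fin (n + 1) => ℂ) 0
  have hℓ : ℓ ≠ 0 := fun hℓ => by simpa [ℓ] using congr($hℓ (Pi.single 0 1))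
  obtain ⟨Q, hQ, hGQ⟩ := exists_eventually_eq_smul_of_vanishing_on_hyperplane hG hℓ
    (by simpa [ℓ, hx0] using hG0)
  refine ⟨_, h.isLocalModel.holAt_comp hx hQ, ?_⟩
  filter_upwards [huG, (h.eventually_comp_iff hx).2 hGQ] with y huy hGy
  rw [huy, hGy]
  simp [ℓ, hx0]

theorem eventually_imp_comp_iff (h : IsCoordinates (n + 1) U φ) (hx : x ∈ U) (hx0 : φ x 0 = 0)
    {P : (Fin (n + 1) → ℂ) → Prop} :
    (∀ᶠ y in 𝓝 x, φ y 0 = 0 → P (φ y)) ↔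
      ∀ᶠ t in 𝓝 (Fin.tail (φ x)), P (Fin.cons 0 t) := by
  rw [h.eventually_comp_iff hx (P := fun z => z 0 = 0 → P z)]
  have hcons : (Fin.cons 0 (Fin.tail (φ x)) : Fin (n + 1) → ℂ) = φ x := by
    rw [← hx0, Fin.cons_self_tail]
  constructor <;> intro hP
  · rw [← hcons] at hP
    filter_upwards [(analyticAt_cons_zero _).continuousAt.eventually hP] with t ht using ht rfl
  · filter_upwards [(analyticAt_tail (φ x)).continuousAt.eventually hP] with z hz hz0
    rwa [← hz0, Fin.cons_self_tail] at hz

theorem eventually_eq_zero_or_of_mul (h : IsCoordinates (n + 1) U φ) (hx : x ∈ U)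
    (hx0 : φ x 0 = 0) (hu : HolAt u x) (hv : HolAt v x)
    (huv : ∀ᶠ y in 𝓝 x, φ y 0 = 0 → u y * v y = 0) :
    (∀ᶠ y in 𝓝 x, φ y 0 = 0 → u y = 0) ∨ ∀ᶠ y in 𝓝 x, φ y 0 = 0 → v y = 0 := by
  obtain ⟨A, hA, huA⟩ := (h.hol_iff x hx u).1 hu
  obtain ⟨B, hB, hvB⟩ := (h.hol_iff x hx v).1 hv
  have hcons : (Fin.cons 0 (Fin.tail (φ x)) : Fin (n + 1) → ℂ) = φ x := by
    rw [← hx0, Fin.cons_self_tail]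
  have hAB : ∀ᶠ y in 𝓝 x, φ y 0 = 0 → A (φ y) * B (φ y) = 0 := by
    filter_upwards [huv, huA, hvB] with y hy huy hvy using huy ▸ hvy ▸ hy
  refine (eventually_eq_zero_or_of_eventually_mul_eq_zero
    (AnalyticAt.fun_comp (g := A) (by rwa [hcons]) (analyticAt_cons_zero _))
    (AnalyticAt.fun_comp (g := B) (by rwa [hcons]) (analyticAt_cons_zero _))
    ((h.eventually_imp_comp_iff hx hx0 (P := fun z => A z * B z = 0)).1 hAB)).imp
    (fun h0 => ?_) fun h0 => ?_
  · filter_upwards [huA, (h.eventually_imp_comp_iff hx hx0 (P := fun z => A z = 0)).2 h0]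
      with y huy hy hy0 using huy.trans (hy hy0)
  · filter_upwards [hvB, (h.eventually_imp_comp_iff hx hx0 (P := fun z => B z = 0)).2 h0]
      with y hvy hy hy0 using hvy.trans (hy hy0)

theorem eq_zero_of_pow_mul_eq_pow_mul (h : IsCoordinates (n + 1) U φ) (hx : x ∈ U)
    (hx0 : φ x 0 = 0) (hu : HolAt u x) (hv : HolAt v x) {j k : ℕ} (hjk : j < k)
    (heq : ∀ᶠ y in 𝓝 x, φ y 0 ^ j * v y = φ y 0 ^ k * u y) : v x = 0 := by
  obtain ⟨d, rfl⟩ := Nat.exists_eq_add_of_lt hjk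
  have hdiff : HolAt (fun y => v y + -1 * (φ y 0 ^ (d + 1) * u y)) x :=
    hv.add ((holAt_const _ _).mul (((h.isLocalModel.holAt_coordinate hx 0).pow _).mul hu))
  have hzero := h.eventually_eq_zero_of_pow_mul_eq_zero hx hdiff (j := j) <| by
    filter_upwards [heq] with y hy
    rw [mul_add, hy]
    ring
  simpa [hx0] using hzero.self_of_nhds

theorem vanishesToOrder_iff (h : IsCoordinates (n + 1) U φ) (hx : x ∈ U) (hx0 : φ x 0 = 0)
    {A : Set X} (hA : ∀ y ∈ U, y ∈ A ↔ φ y 0 = 0) {k : ℕ} :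
    VanishesToOrder A x k w ↔ ∃ v, HolAt v x ∧ ∀ᶠ y in 𝓝 x, w y = φ y 0 ^ k * v y := by
  constructor
  · rintro ⟨l, u, hl, hu, hlA, hw⟩
    have hl0 : ∀ᶠ y in 𝓝 x, φ y 0 = 0 → l y = 0 := by
      filter_upwards [hlA, h.mem_nhds hx] with y hy hyU hy0 using hy ((hA y hyU).2 hy0)
    obtain ⟨l', hl', hll'⟩ := h.exists_eq_apply_zero_mul hx hx0 hl hl0
    refine ⟨fun y => u y * l' y ^ k, hu.mul (hl'.pow k), ?_⟩
    filter_upwards [hw, hll'] with y hwy hly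
    rw [hwy, hly, mul_pow]
    ring
  · rintro ⟨v, hv, hw⟩
    refine ⟨fun y => φ y 0, v, h.isLocalModel.holAt_coordinate hx 0, hv, ?_, ?_⟩
    · filter_upwards [h.mem_nhds hx] with y hyU using (hA y hyU).1
    · filter_upwards [hw] with y hwy using hwy.trans (mul_comm _ _)

end Hypersurface

end ComplexSpace.IsCoordinates

namespace ComplexSpace

section ChartDeriv

variable {X : Type*} [TopologicalSpace X] {n : ℕ} {U : Set X} {φ : X → Fin n → ℂ} {x : X}
  {u : X → ℂ}

/-- The derivative at `x` of a function `u` in the coordinates `φ` on `U`, that is, the derivative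
at `φ x` of `u ∘ φ⁻¹`. Outside `φ '' U`, the function `u ∘ φ⁻¹` is given the value `0`. -/
noncomputable def chartDeriv (U : Set X) (φ : X → Fin n → ℂ) (u : X → ℂ) (x : X) :
    (Fin n → ℂ) →L[ℂ] ℂ :=
  fderiv ℂ (Function.extend (U.domRestrict φ) (U.domRestrict u) 0) (φ x)

variable [ComplexSpace X]

theorem IsCoordinates.chartDeriv_eq (h : IsCoordinates n U φ) (hx : x ∈ U)
    {G : (Fin n → ℂ) → ℂ} (hu : ∀ᶠ y in 𝓝 x, u y = G (φ y)) :
    chartDeriv U φ u x = fderiv ℂ G (φ x) := by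
  refine EventuallyEq.fderiv_eq ((h.eventually_comp_iff hx).1 ?_)
  filter_upwards [hu, h.mem_nhds hx] with y hy hyU
  exact (h.isLocalModel.injOn.injective.extend_apply (U.domRestrict u) 0 ⟨y, hyU⟩).trans hy

theorem IsCoordinates.exists_isCoordinates_apply_zero_eq (h : IsCoordinates n U φ) (hx : x ∈ U)
    (hu : HolAt u x) (hd : chartDeriv U φ u x ≠ 0) :
    ∃ (k : ℕ) (V : Set X) (χ : X → Fin (k + 1) → ℂ), x ∈ V ∧ IsCoordinates (k + 1) V χ ∧
      ∀ y ∈ V, χ y 0 = u y := by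
  obtain ⟨G, hG, huG⟩ := (h.hol_iff x hx u).1 hu
  obtain ⟨k, V, χ, hxV, hχ, hχG⟩ := h.exists_apply_zero_eq hx hG (h.chartDeriv_eq hx huG ▸ hd)
  obtain ⟨O, hOu, hO, hxO⟩ := eventually_nhds_iff.1 huG
  exact ⟨k, V ∩ O, χ, ⟨hxV, hxO⟩, hχ.restrict hO, fun y hy => (hχG y).trans (hOu y hy.2).symm⟩

theorem IsCoordinates.eventually_eq_zero_of_chartDeriv_eq_mul (h : IsCoordinates n U φ)
    (hx : x ∈ U) (hu : HolAt u x) (hux : u x = 0)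
    (hd : ∀ d, ∃ r, HolAt r x ∧ ∀ᶠ y in 𝓝 x, chartDeriv U φ u y d = u y * r y) :
    ∀ᶠ y in 𝓝 x, u y = 0 := by
  obtain ⟨G, hG, huG⟩ := (h.hol_iff x hx u).1 hu
  have hG0 : ∀ᶠ z in 𝓝 (φ x), G z = 0 := by
    refine eventually_eq_zero_of_fderiv_eventually_eq_mul hG (huG.self_of_nhds.symm.trans hux)
      fun d => ?_
    obtain ⟨r, hr, hur⟩ := hd d
    obtain ⟨R, hR, hrR⟩ := (h.hol_iff x hx r).1 hr
    refine ⟨R, hR, (h.eventually_comp_iff hx).1 ?_⟩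
    filter_upwards [huG.eventually_nhds, hur, hrR, h.mem_nhds hx] with y huy hy hry hyU
    rw [← h.chartDeriv_eq hyU huy, hy, hry, huy.self_of_nhds]
  filter_upwards [huG, (h.eventually_comp_iff hx).2 hG0] with y huy hy using huy.trans hy

end ChartDeriv

section Slice

variable {X : Type*} [TopologicalSpace X] [ComplexSpace X] {T : Type*} [TopologicalSpace T]
  [ComplexSpace T] {w : X × T → ℂ} {x : X} {t : T}

theorem HolAt.slice (hw : HolAt w (x, t)) : HolAt (fun y => w (y, t)) x := by
  obtain ⟨n, U, φ, Ω, hx, h⟩ := exists_localModel x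
  obtain ⟨m, V, ψ, Θ, ht, k⟩ := exists_localModel t
  obtain ⟨G, hG, hwG⟩ := ((h.prod_holAt k).hol_iff _ (mk_mem_prod hx ht) w).1 hw
  exact (h.hol_iff x hx _).2 ⟨fun z => G (Fin.append z (ψ t)),
    AnalyticAt.fun_comp (g := G) hG (analyticAt_append_left _ _),
    (Continuous.prodMk_left t).continuousAt.eventually hwG⟩

theorem HolAt.chartDeriv_slice {n : ℕ} {U : Set X} {φ : X → Fin n → ℂ} (hw : HolAt w (x, t))
    (h : IsCoordinates n U φ) (hx : x ∈ U) (d : Fin n → ℂ) :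
    HolAt (fun p : X × T => chartDeriv U φ (fun y => w (y, p.2)) p.1 d) (x, t) := by
  obtain ⟨m, V, ψ, Θ, ht, k⟩ := exists_localModel t
  have hprod := h.isLocalModel.prod_holAt k
  have hxt : (x, t) ∈ U ×ˢ V := mk_mem_prod hx ht
  obtain ⟨G, hG, hwG⟩ := (hprod.hol_iff _ hxt w).1 hw
  refine (hprod.holAt_comp hxt (analyticAt_fderiv_apply hG (appendL n m (d, 0)))).congr ?_
  filter_upwards [(hprod.continuousAt hxt).eventually hG.eventually_analyticAt,
    hwG.eventually_nhds, hprod.mem_nhds hxt] with p hGp hwp hp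
  have hslice : ∀ᶠ y in 𝓝 p.1, w (y, p.2) = G (Fin.append (φ y) (ψ p.2)) :=
    (Continuous.prodMk_left p.2).continuousAt.eventually hwp
  have hfderiv := (hGp.differentiableAt.hasFDerivAt.comp (f := fun z => Fin.append z (ψ p.2))
    (φ p.1) (hasFDerivAt_append_left (φ p.1) (ψ p.2))).fderiv
  exact congr($((h.chartDeriv_eq hp.1 hslice).trans hfderiv) d)

end Slice

end ComplexSpace

namespace ComplexSpace

section Divisor

variable {X : Type*} [TopologicalSpace X] [ComplexSpace X]
  {Y : Type*} [TopologicalSpace Y] [ComplexSpace Y] {Δ : OrbifoldDivisor Y} {f : X → Y}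
  {D : Set Y} {x : X}

theorem IsOrbifoldMorphism.mult_le_pullbackMultiplicity
    (hf : IsOrbifoldMorphism (OrbifoldDivisor.trivial X) Δ f) (hD : IsPrimeDivisor D)
    {E : Set X} (hE : IsDivisorComponent (f ⁻¹' D) E) : Δ.mult D ≤ pullbackMultiplicity f D E := by
  simpa only [OrbifoldDivisor.trivial, mul_one] using hf.mult_le D hD E hE

theorem IsOrbifoldMorphism.mult_le_pullbackOrderAt
    (hf : IsOrbifoldMorphism (OrbifoldDivisor.trivial X) Δ f) (hD : IsPrimeDivisor D)
    (hx : x ∈ hypersurfaceLocus (f ⁻¹' D)) : Δ.mult D ≤ pullbackOrderAt f D x :=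
  (hf.mult_le_pullbackMultiplicity hD ⟨x, hx, rfl⟩).trans
    (iInf₂_le x ⟨subset_closure (mem_connectedComponentIn hx), hx⟩)

theorem IsOrbifoldMorphism.preimage_notMem_nhds {ΔX : OrbifoldDivisor X}
    (hf : IsOrbifoldMorphism ΔX Δ f) (hX : IsPreconnected (regularLocus X))
    (hD : Δ.mult D ≠ 1) : f ⁻¹' D ∉ 𝓝 x := by
  intro hx
  have hfD : f ⁻¹' D = univ :=
    (hf.isHolomorphicMap.isAnalyticSubset_preimage (Δ.isPrimeDivisor D hD).analytic).eq_univ hX hx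
  refine hf.not_subset_support ?_
  rintro _ ⟨y, rfl⟩
  exact ⟨D, hD, hfD.superset (mem_univ y)⟩

theorem IsCoordinates.eq_zero_of_lt_pullbackOrderAt {n : ℕ} {U : Set X} {φ : X → Fin (n + 1) → ℂ}
    (h : IsCoordinates (n + 1) U φ) (hx : x ∈ U) (hx0 : φ x 0 = 0)
    (hU : ∀ y ∈ U, y ∈ f ⁻¹' D ↔ φ y 0 = 0) {j : ℕ} (hj : j < pullbackOrderAt f D x)
    {g : Y → ℂ} (hg : HolAt g (f x)) (hgD : ∀ᶠ y in 𝓝 (f x), y ∈ D → g y = 0) {v : X → ℂ}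
    (hv : HolAt v x) (hgv : ∀ᶠ y in 𝓝 x, g (f y) = φ y 0 ^ j * v y) : v x = 0 := by
  obtain ⟨k, hk⟩ := lt_iSup_iff.1 hj
  obtain ⟨hgk, hjk⟩ := lt_iSup_iff.1 hk
  obtain ⟨u, hu, hgu⟩ := (h.vanishesToOrder_iff hx hx0 hU).1 (hgk g hg hgD)
  refine h.eq_zero_of_pow_mul_eq_pow_mul hx hx0 hu hv (Nat.cast_lt.1 hjk) ?_
  filter_upwards [hgu, hgv] with y hgu hgv using hgv.symm.trans hgu

end Divisor

section Family

variable {X : Type*} [TopologicalSpace X] [ComplexSpace X] {T : Type*} [TopologicalSpace T]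
  [ComplexSpace T] {Y : Type*} [TopologicalSpace Y] [ComplexSpace Y] {Δ : OrbifoldDivisor Y}
  {f : X × T → Y} {D : Set Y} {n N : ℕ} {U : Set X} {φ : X → Fin n → ℂ} {W : Set (X × T)}
  {Φ : X × T → Fin (N + 1) → ℂ} {x : X} {t : T} {g : Y → ℂ} {v : X × T → ℂ} {j : ℕ}

theorem IsCoordinates.eq_zero_of_chartDeriv_slice_ne_zero (hφ : IsCoordinates n U φ) (hx : x ∈ U)
    (hf : IsOrbifoldMorphism (OrbifoldDivisor.trivial X) Δ fun y => f (y, t))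
    (hD : IsPrimeDivisor D) (hΦ : IsCoordinates (N + 1) W Φ) (hxt : (x, t) ∈ W)
    (hxt0 : Φ (x, t) 0 = 0) (hW : ∀ p ∈ W, p ∈ f ⁻¹' D ↔ Φ p 0 = 0)
    (hd : chartDeriv U φ (fun y => Φ (y, t) 0) x ≠ 0)
    (hg : HolAt g (f (x, t))) (hgD : ∀ᶠ y in 𝓝 (f (x, t)), y ∈ D → g y = 0)
    (hv : HolAt v (x, t)) (hj : j < Δ.mult D)
    (hgv : ∀ᶠ p in 𝓝 (x, t), g (f p) = Φ p 0 ^ j * v p) : v (x, t) = 0 := by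
  have hslice : Continuous fun y : X => (y, t) := Continuous.prodMk_left t
  obtain ⟨k, V, χ, hxV, hχ, hχΦ⟩ := hφ.exists_isCoordinates_apply_zero_eq hx
    (hΦ.isLocalModel.holAt_coordinate hxt 0).slice hd
  have hχ' := hχ.restrict (hΦ.isOpen_source.preimage hslice)
  have hxV' : x ∈ V ∩ (fun y => (y, t)) ⁻¹' W := ⟨hxV, hxt⟩
  have hx0 : χ x 0 = 0 := (hχΦ x hxV).trans hxt0
  have hV : ∀ y ∈ V ∩ (fun y => (y, t)) ⁻¹' W, y ∈ (fun y => f (y, t)) ⁻¹' D ↔ χ y 0 = 0 :=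
    fun y hy => by
      rw [hχΦ y hy.1]
      exact hW (y, t) hy.2
  refine hχ'.eq_zero_of_lt_pullbackOrderAt hxV' hx0 hV (v := fun y => v (y, t))
    (hj.trans_le (hf.mult_le_pullbackOrderAt hD ?_)) hg hgD hv.slice ?_
  · exact ⟨(hV x hxV').2 hx0, k, _, χ, hxV', hχ', hV⟩
  · filter_upwards [hslice.continuousAt.eventually hgv, hχ.mem_nhds hxV] with y hy hyV
    rw [hχΦ y hyV]
    exact hy

theorem IsCoordinates.eventually_slice_eq_zero (hφ : IsCoordinates n U φ) (hx : x ∈ U)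
    (hΦ : IsCoordinates (N + 1) W Φ) (hxt : (x, t) ∈ W) (hxt0 : Φ (x, t) 0 = 0)
    (hd : ∀ d, ∀ᶠ p in 𝓝 (x, t),
      Φ p 0 = 0 → chartDeriv U φ (fun y => Φ (y, p.2) 0) p.1 d = 0) :
    ∀ᶠ y in 𝓝 x, Φ (y, t) 0 = 0 := by
  have hcoord := hΦ.isLocalModel.holAt_coordinate hxt 0
  refine hφ.eventually_eq_zero_of_chartDeriv_eq_mul hx hcoord.slice hxt0 fun d => ?_
  obtain ⟨r, hr, hΦr⟩ := hΦ.exists_eq_apply_zero_mul hxt hxt0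
    (hcoord.chartDeriv_slice hφ hx d) (hd d)
  exact ⟨_, hr.slice, (Continuous.prodMk_left t).continuousAt.eventually hΦr⟩

theorem IsCoordinates.eventually_eq_zero_of_slices (hX : IsPreconnected (regularLocus X))
    (hf : IsHolomorphicMap f)
    (hfΔ : ∀ t, IsOrbifoldMorphism (OrbifoldDivisor.trivial X) Δ fun y => f (y, t))
    (hD : Δ.mult D ≠ 1) (hΦ : IsCoordinates (N + 1) W Φ) (hxt : (x, t) ∈ W)
    (hxt0 : Φ (x, t) 0 = 0) (hW : ∀ p ∈ W, p ∈ f ⁻¹' D ↔ Φ p 0 = 0)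
    (hg : HolAt g (f (x, t))) (hgD : ∀ᶠ y in 𝓝 (f (x, t)), y ∈ D → g y = 0)
    (hv : HolAt v (x, t)) (hj : j < Δ.mult D)
    (hgv : ∀ᶠ p in 𝓝 (x, t), g (f p) = Φ p 0 ^ j * v p) :
    ∀ᶠ p in 𝓝 (x, t), Φ p 0 = 0 → v p = 0 := by
  obtain ⟨n, U, φ, hxU, hφ⟩ := mem_regularLocus_of_prodMk_mem ⟨N + 1, W, Φ, hxt, hΦ⟩
  have hfxt := hf.continuous.continuousAt (x := (x, t))
  have hcoord := hΦ.isLocalModel.holAt_coordinate hxt 0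
  have hprod : ∀ d, ∀ᶠ p in 𝓝 (x, t), Φ p 0 = 0 →
      v p * chartDeriv U φ (fun y => Φ (y, p.2) 0) p.1 d = 0 := fun d => by
    filter_upwards [hΦ.mem_nhds hxt, continuousAt_fst.eventually_mem (hφ.mem_nhds hxU),
      hfxt.eventually hg.eventually, hfxt.eventually hgD.eventually_nhds, hv.eventually,
      hgv.eventually_nhds] with p hpW hpU hgp hgDp hvp hgvp hp0
    by_cases hd : chartDeriv U φ (fun y => Φ (y, p.2) 0) p.1 = 0
    · rw [hd, zero_apply, mul_zero]
    · rw [hφ.eq_zero_of_chartDeriv_slice_ne_zero hpU (hfΔ p.2) (Δ.isPrimeDivisor D hD) hΦ hpW hp0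
        hW hd hgp hgDp hvp hj hgvp, zero_mul]
  by_contra hne
  have hzero := hφ.eventually_slice_eq_zero hxU hΦ hxt hxt0 fun d =>
    (hΦ.eventually_eq_zero_or_of_mul hxt hxt0 hv (hcoord.chartDeriv_slice hφ hxU d)
      (hprod d)).resolve_left hne
  refine (hfΔ t).preimage_notMem_nhds (x := x) hX hD ?_
  filter_upwards [hzero, (Continuous.prodMk_left t).continuousAt.eventually_mem (hΦ.mem_nhds hxt)]
    with y hy0 hyW using (hW _ hyW).2 hy0

theorem IsCoordinates.exists_eq_pow_mul_of_slices (hX : IsPreconnected (regularLocus X))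
    (hf : IsHolomorphicMap f)
    (hfΔ : ∀ t, IsOrbifoldMorphism (OrbifoldDivisor.trivial X) Δ fun y => f (y, t))
    (hΦ : IsCoordinates (N + 1) W Φ) {p : X × T} (hp : p ∈ W) (hp0 : Φ p 0 = 0)
    (hW : ∀ q ∈ W, q ∈ f ⁻¹' D ↔ Φ q 0 = 0) (hg : HolAt g (f p))
    (hgD : ∀ᶠ y in 𝓝 (f p), y ∈ D → g y = 0) {k : ℕ} (hk : k ≤ Δ.mult D) :
    ∃ v, HolAt v p ∧ ∀ᶠ q in 𝓝 p, g (f q) = Φ q 0 ^ k * v q := by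
  induction k with
  | zero => exact ⟨_, hf.holAt_comp p g hg, by simp⟩
  | succ k ih =>
    have hklt : (k : ℕ∞) < Δ.mult D := (Nat.cast_lt.2 k.lt_succ_self).trans_le hk
    obtain ⟨v, hv, hgv⟩ := ih hklt.le
    have hv0 : ∀ᶠ q in 𝓝 p, Φ q 0 = 0 → v q = 0 := by
      rcases k.eq_zero_or_pos with rfl | hkpos
      · filter_upwards [hgv, hf.continuous.continuousAt.eventually hgD, hΦ.mem_nhds hp]
          with q hgv hgD hqW hq0
        rw [← one_mul (v q), ← pow_zero (Φ q 0), ← hgv, hgD ((hW q hqW).2 hq0)]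
      · have hD : Δ.mult D ≠ 1 := ((Nat.one_le_cast.2 hkpos).trans_lt hklt).ne'
        exact hΦ.eventually_eq_zero_of_slices hX hf hfΔ hD hp hp0 hW hg hgD hv hklt hgv
    obtain ⟨v', hv', hvv'⟩ := hΦ.exists_eq_apply_zero_mul hp hp0 hv hv0
    refine ⟨v', hv', ?_⟩
    filter_upwards [hgv, hvv'] with q hgv hvq
    rw [hgv, hvq, pow_succ, mul_assoc]

theorem mult_le_pullbackMultiplicity_of_slices (hX : IsPreconnected (regularLocus X))
    (hf : IsHolomorphicMap f)
    (hfΔ : ∀ t, IsOrbifoldMorphism (OrbifoldDivisor.trivial X) Δ fun y => f (y, t))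
    (D : Set Y) (E : Set (X × T)) : Δ.mult D ≤ pullbackMultiplicity f D E := by
  refine le_iInf₂ fun p hp => ENat.forall_natCast_le_iff_le.1 fun k hk => ?_
  obtain ⟨-, hpD, N, W, Φ, hpW, hΦ, hW⟩ := hp
  have hp0 : Φ p 0 = 0 := (hW p hpW).1 hpD
  exact le_iSup₂_of_le k (fun g hg hgD => (hΦ.vanishesToOrder_iff hpW hp0 hW).2
    (hΦ.exists_eq_pow_mul_of_slices hX hf hfΔ hpW hp0 hW hg hgD hk)) le_rfl

end Family

end ComplexSpace

theorem mainTheorem10_general {X : Type*} [TopologicalSpace X] [ComplexSpace X]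
    {T : Type*} [TopologicalSpace T] [ComplexSpace T] [Nonempty T]
    {Y : Type*} [TopologicalSpace Y] [ComplexSpace Y]
    (hX : IsPreconnected (ComplexSpace.regularLocus X)) (Δ : ComplexSpace.OrbifoldDivisor Y)
    {f : X × T → Y} (hf : ComplexSpace.IsHolomorphicMap f)
    (hfΔ : ∀ t, ComplexSpace.IsOrbifoldMorphism (ComplexSpace.OrbifoldDivisor.trivial X) Δ
      fun x => f (x, t)) :
    ComplexSpace.IsOrbifoldMorphism (ComplexSpace.OrbifoldDivisor.trivial (X × T)) Δ f where
  isHolomorphicMap := hf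
  not_subset_support hsub := by
    obtain ⟨t⟩ := ‹Nonempty T›
    exact (hfΔ t).not_subset_support
      ((range_comp_subset_range (fun x => (x, t)) f).trans hsub)
  mult_le D _ E _ := by
    simpa only [ComplexSpace.OrbifoldDivisor.trivial, mul_one] using
      ComplexSpace.mult_le_pullbackMultiplicity_of_slices hX hf hfΔ D E

theorem mainTheorem10 {X : Type*} [TopologicalSpace X] [ComplexSpace X]
    {Y : Type*} [TopologicalSpace Y] [ComplexSpace Y]
    (hX : ComplexSpace.IsNormalVariety X) (hY : ComplexSpace.IsNormalVariety Y)
    (Δ : ComplexSpace.OrbifoldDivisor Y)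
    (F : Set (ComplexSpace.HolMap X Y))
    (hFΔ : ∀ f ∈ F, ComplexSpace.IsOrbifoldMorphism
      (ComplexSpace.OrbifoldDivisor.trivial X) Δ f.toFun)
    (hFlc : IsLocallyClosed F)
    [ComplexSpace F] (hF : ComplexSpace.IsNormalVariety F)
    (hev : ComplexSpace.IsHolomorphicMap (ComplexSpace.evalMap F)) :
    ComplexSpace.IsOrbifoldMorphism (ComplexSpace.OrbifoldDivisor.trivial (X × F)) Δ
        (ComplexSpace.evalMap F) ∧
      ∀ D : Set Y, Δ.mult D ≠ 1 →
        ∀ E : Set (X × F), ComplexSpace.IsDivisorComponent (ComplexSpace.evalMap F ⁻¹' D) E →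
          Δ.mult D ≤ ComplexSpace.pullbackMultiplicity (ComplexSpace.evalMap F) D E := by
  have : Nonempty F := ⟨hF.irreducible.nonempty.some⟩
  have hevΔ := mainTheorem10_general hX.irreducible.isPreconnected Δ hev fun f => hFΔ f.1 f.2
  exact ⟨hevΔ, fun D hD E hE => hevΔ.mult_le_pullbackMultiplicity (Δ.isPrimeDivisor D hD) hE⟩
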